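/- Let $G$ be a finite connected bipartite undirected graph (parallel edges are allowed), let $A_G$ be its adjacency matrix, and let $\rho(G)$ be the spectral radius of the universal covering tree $T$ of $G$, that is, of the adjacency operator $(A_Tf)(v)=\sum_{u\sim v}f(u)$ acting on $\ell^2(V(T))$. If $H$ is an $r$-sheeted covering of $G$, then the multiset of eigenvalues of $A_H$ contains the multiset of eigenvalues of $A_G$; the remaining $(r-1)|V(G)|$ eigenvalues of $A_H$ (with multiplicity) are called new. Then for every integer $r\ge 1$ there is an $r$-sheeted covering $H$ of $G$ (not necessarily connected) which is Ramanujan, that is, all of whose new eigenvalues lie in the interval $[-\rho(G),\rho(G)]$. -/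

import Mathlib

open scoped ENNReal

/-! ### Multigraphs -/

/-- An undirected multigraph (parallel edges and loops allowed) with vertex type `V` and edge
type `E`.  As usual, an (arbitrary) orientation of every edge is chosen: the edge `e` joins
`src e` and `tgt e`. -/
structure MultiGraph (V E : Type*) where
  src : E → V
  tgt : E → V

namespace MultiGraph

section Basic

variable {V E : Type*} (G : MultiGraph V E)

/-- The oriented edges: every edge `e` gives rise to two of them, `(e, true)`, which runs from
`src e` to `tgt e`, and `(e, false)`, which runs from `tgt e` to `src e`. -/
abbrev Dart (_ : MultiGraph V E) : Type _ := E × Bool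

/-- The vertex at which an oriented edge starts. -/
def tail (d : G.Dart) : V := bif d.2 then G.src d.1 else G.tgt d.1

/-- The vertex at which an oriented edge ends. -/
def head (d : G.Dart) : V := bif d.2 then G.tgt d.1 else G.src d.1

/-- The same edge with the opposite orientation. -/
def rev (d : G.Dart) : G.Dart := (d.1, !d.2)

/-- The simple graph in which two distinct vertices are adjacent if some edge joins them. -/
def toSimple : SimpleGraph V := SimpleGraph.fromRel fun u v => ∃ e, G.src e = u ∧ G.tgt e = v

/-- A multigraph is connected if it is nonempty and any two vertices are joined by a walk. -/
def Connected : Prop := G.toSimple.Connected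

/-- A multigraph is bipartite if its vertices have a 2-colouring for which the two ends of every
edge get different colours (so there are no loops). -/
def Bipartite : Prop := ∃ c : V → Bool, ∀ e, c (G.src e) ≠ c (G.tgt e)

/-- The adjacency matrix: the entry at `(u, v)` is the number of oriented edges from `u` to `v`
(so a loop at `v` contributes `2` to the entry at `(v, v)`). -/
def adjMatrix [Fintype E] [DecidableEq V] : Matrix V V ℝ :=
  Matrix.of fun u v =>
    ((Finset.univ.filter fun d : G.Dart => G.tail d = u ∧ G.head d = v).card : ℝ)

/-- The eigenvalues of the (real symmetric) adjacency matrix, with multiplicities. -/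
noncomputable def spec [Fintype V] [DecidableEq V] [Fintype E] : Multiset ℝ :=
  G.adjMatrix.charpoly.roots

end Basic

/-! ### Coverings -/

/-- A morphism of multigraphs: a map of vertices and a map of oriented edges that respect tails
and the reversal of orientation (and hence heads). -/
structure Hom {W F V E : Type*} (H : MultiGraph W F) (G : MultiGraph V E) where
  onVert : W → V
  onDart : H.Dart → G.Dart
  tail_onDart : ∀ d, G.tail (onDart d) = onVert (H.tail d)
  onDart_rev : ∀ d, onDart (H.rev d) = G.rev (onDart d)

section Covering

variable {W F V E : Type*} {H : MultiGraph W F} {G : MultiGraph V E}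

/-- `p : H → G` is an `r`-sheeted covering map: for every vertex `w` of `H` it maps the oriented
edges starting at `w` bijectively onto the oriented edges starting at `p w`, and every vertex
of `G` has exactly `r` preimages. -/
structure Hom.IsCovering (p : Hom H G) (r : ℕ) : Prop where
  bijOn : ∀ w : W, Set.BijOn p.onDart {d | H.tail d = w} {d | G.tail d = p.onVert w}
  encard_fiber : ∀ v : V, {w | p.onVert w = v}.encard = r

/-- The new eigenvalues of a covering `p : H → G`: the eigenvalues of `H` without the old ones,
which are the eigenvalues of `G`.  This is a difference of multisets. -/
noncomputable def Hom.newEigenvalues [Fintype W] [DecidableEq W] [Fintype F] [Fintype V]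
    [DecidableEq V] [Fintype E] (_ : Hom H G) : Multiset ℝ :=
  H.spec - G.spec

end Covering

end MultiGraph

/-! ### The adjacency operator on `ℓ²` of a graph of bounded degree -/

section AdjOperator

variable {X : Type*} (T : SimpleGraph X) [T.LocallyFinite]

theorem SimpleGraph.sum_sq_neighbors_le (D : ℕ) (hD : ∀ x, T.degree x ≤ D)
    (f : lp (fun _ : X => ℂ) 2) (s : Finset X) :
    ∑ x ∈ s, ‖∑ y ∈ T.neighborFinset x, f y‖ ^ (2 : ℝ≥0∞).toReal
      ≤ ((D : ℝ) * ‖f‖) ^ (2 : ℝ≥0∞).toReal := by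
  classical
  have h2 : (2 : ℝ≥0∞).toReal = ((2 : ℕ) : ℝ) := by norm_num
  have h0 : (0 : ℝ) < (2 : ℝ≥0∞).toReal := by norm_num
  have hf : ∀ t : Finset X, ∑ y ∈ t, ‖f y‖ ^ 2 ≤ ‖f‖ ^ 2 := by
    intro t
    have := lp.sum_rpow_le_norm_rpow h0 f t
    simpa [h2] using this
  simp only [h2, Real.rpow_natCast]
  have h1 : ∀ x ∈ s, ‖∑ y ∈ T.neighborFinset x, f y‖ ^ 2
      ≤ (D : ℝ) * ∑ y ∈ T.neighborFinset x, ‖f y‖ ^ 2 := by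
    intro x _
    calc ‖∑ y ∈ T.neighborFinset x, f y‖ ^ 2
        ≤ (∑ y ∈ T.neighborFinset x, ‖f y‖) ^ 2 := by
          gcongr
          exact norm_sum_le _ _
      _ ≤ ((T.neighborFinset x).card : ℝ) * ∑ y ∈ T.neighborFinset x, ‖f y‖ ^ 2 :=
          sq_sum_le_card_mul_sum_sq
      _ ≤ _ := by
          gcongr
          rw [T.card_neighborFinset_eq_degree]
          exact hD x
  have h3 : ∑ x ∈ s, ∑ y ∈ T.neighborFinset x, ‖f y‖ ^ 2 ≤ (D : ℝ) * ‖f‖ ^ 2 := by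
    rw [Finset.sum_comm' (t' := s.biUnion fun x => T.neighborFinset x)
      (s' := fun y => s.filter fun x => T.Adj x y)]
    · calc ∑ y ∈ s.biUnion fun x => T.neighborFinset x,
            ∑ x ∈ s.filter (fun x => T.Adj x y), ‖f y‖ ^ 2
          ≤ ∑ y ∈ s.biUnion fun x => T.neighborFinset x, (D : ℝ) * ‖f y‖ ^ 2 := by
            refine Finset.sum_le_sum fun y _ => ?_
            rw [Finset.sum_const, nsmul_eq_mul]
            gcongr
            refine le_trans (Finset.card_le_card ?_) (hD y)
            intro x hx
            simpa [SimpleGraph.adj_comm] using (Finset.mem_filter.1 hx).2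
        _ ≤ _ := by
            rw [← Finset.mul_sum]
            gcongr
            exact hf _
    · intro x y
      simp only [SimpleGraph.mem_neighborFinset, Finset.mem_filter, Finset.mem_biUnion]
      exact ⟨fun h => ⟨h, x, h⟩, fun h => h.1⟩
  calc _ ≤ ∑ x ∈ s, (D : ℝ) * ∑ y ∈ T.neighborFinset x, ‖f y‖ ^ 2 := Finset.sum_le_sum h1
    _ = (D : ℝ) * ∑ x ∈ s, ∑ y ∈ T.neighborFinset x, ‖f y‖ ^ 2 := by rw [Finset.mul_sum]
    _ ≤ (D : ℝ) * ((D : ℝ) * ‖f‖ ^ 2) := by gcongr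
    _ = _ := by ring

/-- The adjacency operator `(A f) x = ∑_{y ∼ x} f y` of a graph whose degrees are at most `D`,
as a bounded operator on the complex Hilbert space `ℓ²(X)`. -/
noncomputable def SimpleGraph.adjOperator (D : ℕ) (hD : ∀ x, T.degree x ≤ D) :
    lp (fun _ : X => ℂ) 2 →L[ℂ] lp (fun _ : X => ℂ) 2 :=
  LinearMap.mkContinuous
    { toFun := fun f => ⟨fun x => ∑ y ∈ T.neighborFinset x, f y,
        memℓp_gen' (T.sum_sq_neighbors_le D hD f)⟩
      map_add' := fun f g => by
        ext x
        exact Finset.sum_add_distrib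
      map_smul' := fun c f => by
        ext x
        simp [Finset.mul_sum] }
    D
    (fun f => lp.norm_le_of_forall_sum_le (by norm_num) (by positivity)
      (T.sum_sq_neighbors_le D hD f))

theorem SimpleGraph.adjOperator_apply (D : ℕ) (hD : ∀ x, T.degree x ≤ D)
    (f : lp (fun _ : X => ℂ) 2) (x : X) :
    T.adjOperator D hD f x = ∑ y ∈ T.neighborFinset x, f y := rfl

end AdjOperator

/-! ### The universal covering tree and its spectral radius -/

namespace MultiGraph

section UniversalCover

variable {V E : Type*} (G : MultiGraph V E)

/-- The non-backtracking walks of `G` that end at the base vertex `v₀`, given as the list of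
their successive oriented edges (the empty list is the walk of length `0` at `v₀`).  They are
the vertices of the universal covering tree; a walk lies above the vertex where it starts. -/
def UnivCover (v₀ : V) : Type _ :=
  {l : List G.Dart // l.IsChain (fun a b => G.head a = G.tail b ∧ b ≠ G.rev a) ∧
    ∀ d ∈ l.getLast?, G.head d = v₀}

/-- The universal covering tree of (the component of `v₀` in) `G`: two non-backtracking walks are
adjacent if one of them is the other one with one oriented edge added at its free end. -/
def univCoverTree (v₀ : V) : SimpleGraph (G.UnivCover v₀) where
  Adj w w' := (∃ d, w'.1 = d :: w.1) ∨ (∃ d, w.1 = d :: w'.1)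
  symm := ⟨fun _ _ h => h.symm⟩
  loopless := ⟨fun w h => by
    rcases h with ⟨d, h⟩ | ⟨d, h⟩ <;> simpa using congrArg List.length h⟩

theorem univCoverTree_neighbors [Fintype E] [DecidableEq E] (v₀ : V) (w : G.UnivCover v₀) :
    Subtype.val '' (G.univCoverTree v₀).neighborSet w ⊆
      ((insert w.1.tail (Finset.univ.image fun d : G.Dart => d :: w.1) :
        Finset (List G.Dart)) : Set (List G.Dart)) := by
  rintro _ ⟨w', h | h, rfl⟩
  · obtain ⟨d, h⟩ := h
    simp [h]
  · obtain ⟨d, h⟩ := h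
    simp [h]

noncomputable instance univCoverTreeLocallyFinite [Fintype E] (v₀ : V) :
    (G.univCoverTree v₀).LocallyFinite := fun w => by
  classical
  exact ((Set.Finite.subset (Finset.finite_toSet _)
    (G.univCoverTree_neighbors v₀ w)).of_finite_image (Subtype.val_injective.injOn)).fintype

theorem univCoverTree_degree_le [Fintype E] (v₀ : V) (w : G.UnivCover v₀) :
    (G.univCoverTree v₀).degree w ≤ Fintype.card G.Dart + 1 := by
  classical
  rw [← SimpleGraph.card_neighborFinset_eq_degree,
    ← Finset.card_image_of_injective (f := fun x : G.UnivCover v₀ => x.1) _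
      Subtype.val_injective]
  refine le_trans (Finset.card_le_card (t := insert w.1.tail
    (Finset.univ.image fun d : G.Dart => d :: w.1)) ?_) ?_
  · intro l hl
    have := G.univCoverTree_neighbors v₀ w (a := l)
    simp only [Finset.mem_image, SimpleGraph.mem_neighborFinset] at hl
    exact_mod_cast this hl
  · exact le_trans (Finset.card_insert_le _ _) (by gcongr; exact Finset.card_image_le)

/-- `ρ(G)`: the spectral radius of the adjacency operator on `ℓ²` of the universal covering tree.
For connected `G` the tree does not depend, up to isomorphism, on the base vertex. -/
noncomputable def rho [Fintype E] (v₀ : V) : ℝ :=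
  (spectralRadius ℂ ((G.univCoverTree v₀).adjOperator _ (G.univCoverTree_degree_le v₀))).toReal

end UniversalCover

/-- A covering `p : H → G` is Ramanujan if all new eigenvalues lie in `[-ρ(G), ρ(G)]`. -/
def Hom.IsRamanujan {W F V E : Type*} [Fintype W] [DecidableEq W] [Fintype F]
    [Fintype V] [DecidableEq V] [Fintype E] {H : MultiGraph W F} {G : MultiGraph V E}
    (p : Hom H G) : Prop :=
  ∀ μ ∈ p.newEigenvalues, ∀ v₀ : V, μ ∈ Set.Icc (-G.rho v₀) (G.rho v₀)

end MultiGraph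

/-! ### Determinants of bordered matrices and rank-one updates -/

namespace Matrix

section Bordered

variable {n R : Type*} [Fintype n] [DecidableEq n] [CommRing R]

/-! The argument is the method of interlacing families, applied to the coverings with fibre `Fin (d
+ 1)`, `r = d + 1`, given by one permutation per edge. The new eigenvalues of such a covering are
those of the adjacency matrix twisted by the standard `d`-dimensional representation of the
symmetric group (`newEigenvalues_permCoverHom`). For bipartite `G` this spectrum is symmetric about
`0`, so an upper bound by `ρ(G)` suffices. Two things are needed: the sum of the new characteristic
polynomials over all coverings is positive above `ρ(G)`, and some single covering does as well as
the sum.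

Positivity of the sum. Averages of `det (M + P g Q + P' g⁻¹ Q')` over the standard representation of
`S_{d+1}` and over the signed permutations of `d` letters coincide. Each average is in fact
invariant under moving an arbitrary matrix from the left of `g` to the right of `g⁻¹`
(`slides_stdPerm`, `slides_signedPerm`), and comparing both with the average over products gives the
equality (`card_mul_sum_det_eq`). The edges are then exchanged one at a time. The result is a sum
over random signings of `d`-sheeted coverings, which obeys the recursion of the matching polynomial
(`signSum_eq`). For `t > ρ(G)` the universal covering tree carries a positive function `f` with `A f
≤ t' f` for some `t' < t`, namely a Green function, and `f` controls the ratios in that recursion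
(`signSum_pos_of_supersolution`).

One covering as good as the sum. Conjugating a symmetric matrix by a transposition changes it by a
difference of two positive rank-one matrices (`submatrix_swap_eq`), so the two characteristic
polynomials have a common interlacer. Hence a random swap preserves real-rootedness, and a bound for
the roots of the average passes to one of the two terms. The uniform average over a symmetric group
is a composition of random swaps (`IsGoodOp.permAvg_perm`), so the bound descends to one choice of
permutations. The interlacing works with the full adjacency matrix of the covering; a multiple of `1
⊗ J`, with `J` the all-ones matrix, is subtracted to push the old eigenvalues below `ρ(G)` without
touching the new ones (`charpoly_adjMatrix_permCover_sub`). -/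

theorem det_updateRow_eq_sum_adjugate (N : Matrix n n R) (x : n) (r : n → R) :
    (N.updateRow x r).det = ∑ y, r y * N.adjugate y x := by
  rw [← cramer_transpose_apply, cramer_eq_adjugate_mulVec, ← adjugate_transpose]
  simp [mulVec, dotProduct, mul_comm]

theorem det_updateCol_eq_sum_adjugate (N : Matrix n n R) (x : n) (c : n → R) :
    (N.updateCol x c).det = ∑ y, c y * N.adjugate x y := by
  rw [← cramer_apply, cramer_eq_adjugate_mulVec]
  simp [mulVec, dotProduct, mul_comm]

/-- Expansion of the determinant of a matrix along both the row and the column of index `v`. -/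
theorem det_updateRow_updateCol (N : Matrix n n R) (v : n) (hrow : N v = Pi.single v 1)
    (r c : n → R) :
    ((N.updateRow v r).updateCol v c).det = c v * N.det -
      ∑ x ∈ Finset.univ.erase v, ∑ y ∈ Finset.univ.erase v, c x * r y * N.adjugate y x := by
  have hv : (N.updateRow v (Pi.single v 1)) = N := by
    rw [← hrow, updateRow_eq_self]
  rw [det_updateCol_eq_sum_adjugate, ← Finset.add_sum_erase _ _ (Finset.mem_univ v), sub_eq_add_neg,
    ← Finset.sum_neg_distrib]
  congr 1
  · rw [adjugate_apply, updateRow_idem, hv]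
  · refine Finset.sum_congr rfl fun x hx => ?_
    have hx : x ≠ v := Finset.ne_of_mem_erase hx
    -- Exchanging the rows `v` and `x` puts the unit row back at `v` and `r` in the row `x`, at the
    -- cost of a sign.
    have h1 : (N.updateRow v r).adjugate v x = -(N.updateRow x r).det := by
      rw [adjugate_apply, ← neg_eq_iff_eq_neg]
      have h2 := det_permute (Equiv.swap v x) ((N.updateRow v r).updateRow x (Pi.single v 1))
      rw [Equiv.Perm.sign_swap hx.symm] at h2
      simp only [Units.val_neg, Units.val_one, Int.cast_neg, Int.cast_one, neg_mul, one_mul] at h2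
      rw [← h2]
      congr 1
      ext i j
      rcases eq_or_ne i v with rfl | hi
      · simp [updateRow_apply, hrow, hx.symm]
      · rcases eq_or_ne i x with rfl | hi'
        · simp [updateRow_apply, hx.symm]
        · simp [updateRow_apply, Equiv.swap_apply_of_ne_of_ne hi hi', hi, hi']
    rw [h1, det_updateRow_eq_sum_adjugate, ← Finset.add_sum_erase _ _ (Finset.mem_univ v)]
    have h3 : N.adjugate v x = 0 := by
      rw [adjugate_apply]
      exact det_zero_of_row_eq hx.symm (by simp [hx.symm, hrow])
    rw [h3, mul_zero, zero_add, mul_neg, Finset.mul_sum]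
    simp only [mul_assoc]

/-- A diagonal cofactor sees neither the row nor the column `x`, so the entries of `N'` in the
column `x` are irrelevant. -/
theorem adjugate_apply_self_of_row (N : Matrix n n R) (x : n) (N' : Matrix n n R)
    (h1 : N' x = Pi.single x 1) (h2 : ∀ i j, i ≠ x → j ≠ x → N' i j = N i j) :
    N.adjugate x x = N'.det := by
  have h := det_updateRow_updateCol N' x h1 (Pi.single x 1) (fun i => if i = x then 1 else N i x)
  have h0 : ∀ a ∈ Finset.univ.erase x, ∑ y ∈ Finset.univ.erase x,
      (if a = x then 1 else N a x) * (Pi.single x (1 : R) : n → R) y * N'.adjugate y a = 0 := by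
    intro a _
    refine Finset.sum_eq_zero fun y hy => ?_
    simp [Finset.ne_of_mem_erase hy]
  rw [Finset.sum_eq_zero h0] at h
  simp only [if_true, one_mul, sub_zero] at h
  rw [← h, adjugate_apply]
  congr 1
  ext i j
  simp only [updateRow_apply, updateCol_apply]
  split_ifs with hi hj hj
  · subst hi; subst hj; simp
  · rfl
  · subst hj; rfl
  · rw [h2 i j hi hj]

end Bordered

/-! ### Rank-one updates -/

section RankOne

variable {m R : Type*} [Fintype m] [DecidableEq m] [CommRing R]

/-- The matrix determinant lemma, for matrices that need not be invertible. -/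
theorem det_add_vecMulVec_eq (A : Matrix m m R) (x y : m → R) :
    (A + vecMulVec x y).det = A.det + y ⬝ᵥ (A.adjugate *ᵥ x) := by
  classical
  -- Border `A` by a one-by-one identity block. The determinant of the matrix bordered by `x` and
  -- `-y` is computed twice, by the Schur complement and by expansion along the border.
  set N : Matrix (Unit ⊕ m) (Unit ⊕ m) R := fromBlocks 1 0 0 A with hN
  have hadj : ∀ i j, N.adjugate (Sum.inr i) (Sum.inr j) = A.adjugate i j := by
    intro i j
    rw [adjugate_apply, adjugate_apply]
    have : N.updateRow (Sum.inr j) (Pi.single (Sum.inr i) 1) =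
        fromBlocks 1 0 0 (A.updateRow j (Pi.single i 1)) := by
      ext a b
      rcases a with a | a <;> rcases b with b | b <;>
        simp [hN, updateRow_apply, fromBlocks, Pi.single_apply]
    rw [this, det_fromBlocks_zero₂₁, det_one, one_mul]
  have hrow : N (Sum.inl ()) = Pi.single (Sum.inl ()) 1 := by
    ext b
    rcases b with b | b <;> simp [hN, fromBlocks]
  have h := det_updateRow_updateCol N (Sum.inl ()) hrow (Sum.elim 1 (-y)) (Sum.elim 1 x)
  have h1 : (N.updateRow (Sum.inl ()) (Sum.elim 1 (-y))).updateCol (Sum.inl ()) (Sum.elim 1 x) =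
      fromBlocks 1 (replicateRow Unit (-y)) (replicateCol Unit x) A := by
    ext a b
    rcases a with a | a <;> rcases b with b | b <;>
      simp [hN, updateRow_apply, fromBlocks]
  rw [h1, det_fromBlocks_one₁₁] at h
  have h2 : A - replicateCol Unit x * replicateRow Unit (-y) = A + vecMulVec x y := by
    ext i j
    simp [mul_apply, vecMulVec_apply]
  have h3 : (Finset.univ : Finset (Unit ⊕ m)).erase (Sum.inl ()) =
      Finset.univ.map Function.Embedding.inr := by
    ext a
    rcases a with a | a <;> simp
  rw [h2, h3, Finset.sum_map] at h
  simp only [Finset.sum_map, Function.Embedding.inr_apply, hadj] at h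
  rw [h, hN, det_fromBlocks_zero₂₁, det_one, one_mul, Sum.elim_inl, Pi.one_apply, one_mul,
    sub_eq_add_neg, ← Finset.sum_neg_distrib]
  congr 1
  simp only [dotProduct, mulVec, Finset.mul_sum, Sum.elim_inr, Pi.neg_apply,
    ← Finset.sum_neg_distrib]
  rw [Finset.sum_comm]
  refine Finset.sum_congr rfl fun i _ => Finset.sum_congr rfl fun j _ => by ring

end RankOne

end Matrix

/-! ### Averages of determinants over families of pairs of matrices -/

namespace Matrix

section Slides

variable {K ι : Type*} [Fintype K] [Fintype ι] [DecidableEq ι]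
variable (n : Type*) [Fintype n] [DecidableEq n] (a b : K → Matrix ι ι ℝ)

/-- The matrix `h` can be moved from the left of `a` to the right of `b` in the sums of
determinants of the form `det (M + P a Q + P' b Q')` over the family of the pairs `(a k, b k)`. -/
def Slides (h : Matrix ι ι ℝ) : Prop :=
  ∀ (M : Matrix n n ℝ) (P : Matrix n ι ℝ) (Q : Matrix ι n ℝ) (P' : Matrix n ι ℝ)
    (Q' : Matrix ι n ℝ),
    ∑ k, (M + P * (h * a k) * Q + P' * b k * Q').det =
      ∑ k, (M + P * a k * Q + P' * (b k * h) * Q').det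

/-- The infinitesimal version of `Slides`. -/
def slideLie : Submodule ℝ (Matrix ι ι ℝ) where
  carrier := {T | ∀ (M : Matrix n n ℝ) (P : Matrix n ι ℝ) (Q : Matrix ι n ℝ) (P' : Matrix n ι ℝ)
    (Q' : Matrix ι n ℝ),
    ∑ k, (a k * Q * (M + P * a k * Q + P' * b k * Q').adjugate * P * T).trace =
      ∑ k, (Q' * (M + P * a k * Q + P' * b k * Q').adjugate * (P' * b k) * T).trace}
  add_mem' := fun hx hy M P Q P' Q' => by
    simp only [mul_add, trace_add, Finset.sum_add_distrib, hx M P Q P' Q', hy M P Q P' Q']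
  zero_mem' := fun M P Q P' Q' => by simp
  smul_mem' := fun c x hx M P Q P' Q' => by
    simp only [Matrix.mul_smul, trace_smul, ← Finset.smul_sum, hx M P Q P' Q']

variable {n a b}

omit [DecidableEq ι] in
theorem trace_mul_vecMulVec_eq (Z : Matrix ι ι ℝ) (x y : ι → ℝ) :
    (Z * vecMulVec x y).trace = y ⬝ᵥ (Z *ᵥ x) := by
  rw [mul_vecMulVec, trace_vecMulVec, dotProduct_comm]

/-- The determinant is affine along a rank-one direction, so for rank-one matrices the infinitesimal
condition is equivalent to the full one. This turns reflections in the group into elements of the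
linear space `slideLie`. -/
theorem slides_one_add_vecMulVec_iff (x y : ι → ℝ) :
    Slides n a b (1 + vecMulVec x y) ↔ vecMulVec x y ∈ slideLie n a b := by
  refine forall_congr' fun M => forall_congr' fun P => forall_congr' fun Q => forall_congr' fun P' =>
    forall_congr' fun Q' => ?_
  have h1 : ∀ k, (M + P * ((1 + vecMulVec x y) * a k) * Q + P' * b k * Q').det =
      (M + P * a k * Q + P' * b k * Q').det +
      (a k * Q * (M + P * a k * Q + P' * b k * Q').adjugate * P * vecMulVec x y).trace := by
    intro k
    have : M + P * ((1 + vecMulVec x y) * a k) * Q + P' * b k * Q' =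
        M + P * a k * Q + P' * b k * Q' + vecMulVec (P *ᵥ x) (y ᵥ* (a k * Q)) := by
      rw [← mul_vecMulVec, ← vecMulVec_mul]
      simp only [Matrix.add_mul, Matrix.mul_add, Matrix.one_mul, Matrix.mul_assoc]
      abel
    rw [this, det_add_vecMulVec_eq, trace_mul_vecMulVec_eq]
    simp only [← mulVec_mulVec, ← dotProduct_mulVec]
  have h2 : ∀ k, (M + P * a k * Q + P' * (b k * (1 + vecMulVec x y)) * Q').det =
      (M + P * a k * Q + P' * b k * Q').det +
      (Q' * (M + P * a k * Q + P' * b k * Q').adjugate * (P' * b k) * vecMulVec x y).trace := by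
    intro k
    have : M + P * a k * Q + P' * (b k * (1 + vecMulVec x y)) * Q' =
        M + P * a k * Q + P' * b k * Q' + vecMulVec ((P' * b k) *ᵥ x) (y ᵥ* Q') := by
      rw [← mul_vecMulVec, ← vecMulVec_mul]
      simp only [Matrix.add_mul, Matrix.mul_add, Matrix.mul_one, Matrix.mul_assoc]
      abel
    rw [this, det_add_vecMulVec_eq, trace_mul_vecMulVec_eq]
    simp only [← mulVec_mulVec, ← dotProduct_mulVec]
  simp only [h1, h2, Finset.sum_add_distrib, add_right_inj]

-- While `h₂` slides, `h₁` is absorbed into `P`; then `h₂` is absorbed into `Q'` while `h₁` slides.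
omit [DecidableEq ι] in
theorem Slides.mul {h₁ h₂ : Matrix ι ι ℝ} (H₁ : Slides n a b h₁) (H₂ : Slides n a b h₂) :
    Slides n a b (h₁ * h₂) := by
  intro M P Q P' Q'
  have e1 := H₂ M (P * h₁) Q P' Q'
  have e2 := H₁ M P Q P' (h₂ * Q')
  simp only [Matrix.mul_assoc] at e1 e2 ⊢
  rw [e1, e2]

theorem Slides.one : Slides n a b 1 := by
  intro M P Q P' Q'
  simp

-- For a family running over a group and its inverses, an element of the group slides by reindexing
-- the sum.
omit [DecidableEq ι] in
theorem slides_of_equiv (φ : K ≃ K) (h : Matrix ι ι ℝ) (h1 : ∀ k, h * a (φ k) = a k)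
    (h2 : ∀ k, b (φ k) = b k * h) : Slides n a b h := by
  intro M P Q P' Q'
  rw [← Equiv.sum_comp φ]
  simp only [h1, h2]

theorem vecMulVec_mem_slideLie_conj {h h' : Matrix ι ι ℝ} (hh : h * h' = 1) (H : Slides n a b h)
    (H' : Slides n a b h') {x y : ι → ℝ} (hxy : vecMulVec x y ∈ slideLie n a b) :
    vecMulVec (h *ᵥ x) (y ᵥ* h') ∈ slideLie n a b := by
  rw [← slides_one_add_vecMulVec_iff] at hxy ⊢
  have := (H.mul hxy).mul H'
  rwa [Matrix.mul_add, Matrix.add_mul, Matrix.mul_one, hh, mul_vecMulVec, vecMulVec_mul] at this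

theorem Slides.one_add_smul {x y : ι → ℝ} (hxy : vecMulVec x y ∈ slideLie n a b) (s : ℝ) :
    Slides n a b (1 + s • vecMulVec x y) := by
  have h := (slideLie n a b).smul_mem s hxy
  rw [← smul_vecMulVec] at h ⊢
  exact (slides_one_add_vecMulVec_iff _ _).2 h

/-- Conjugation by `1 + s x yᵀ`, which slides for every `s`; its inverse is given by the
Sherman–Morrison formula. New rank-one elements are thus produced from two known ones. -/
theorem vecMulVec_conj_rankOne {x y z w : ι → ℝ} (hxy : vecMulVec x y ∈ slideLie n a b)
    (hzw : vecMulVec z w ∈ slideLie n a b) (s : ℝ) (hs : 1 + s * (y ⬝ᵥ x) ≠ 0) :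
    vecMulVec (z + (s * (y ⬝ᵥ z)) • x) (w - (s / (1 + s * (y ⬝ᵥ x)) * (w ⬝ᵥ x)) • y) ∈
      slideLie n a b := by
  have h := vecMulVec_mem_slideLie_conj (h := 1 + s • vecMulVec x y)
    (h' := 1 + (-(s / (1 + s * (y ⬝ᵥ x)))) • vecMulVec x y) ?_
    (Slides.one_add_smul hxy _) (Slides.one_add_smul hxy _) hzw
  · convert h using 2
    · simp [add_mulVec, smul_mulVec, vecMulVec_mulVec, smul_smul]
    · rw [vecMul_add, vecMul_one, vecMul_smul, vecMul_vecMulVec, smul_smul, neg_mul, neg_smul,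
        sub_eq_add_neg]
  · have e : vecMulVec x y * vecMulVec x y = (y ⬝ᵥ x) • vecMulVec x y := by
      rw [vecMulVec_mul_vecMulVec, vecMulVec_smul]
    simp only [Matrix.mul_add, Matrix.add_mul, Matrix.one_mul, Matrix.mul_one, Matrix.smul_mul,
      Matrix.mul_smul, e, smul_smul]
    rw [add_assoc, smul_add, smul_smul, ← add_smul, ← add_smul]
    convert add_zero (1 : Matrix ι ι ℝ)
    convert zero_smul ℝ (vecMulVec x y)
    field_simp
    ring

/-- Every square matrix, singular ones included, is a product of transvections and diagonal
matrices, and these are products of matrices `1 + c E_ij`. -/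
theorem slides_of_single_mem (H : ∀ i j, single i j (1 : ℝ) ∈ slideLie n a b)
    (h : Matrix ι ι ℝ) : Slides n a b h := by
  have H1 : ∀ i j (c : ℝ), Slides n a b (1 + single i j c) := by
    intro i j c
    have e : vecMulVec (Pi.single i 1) (Pi.single j 1) = single i j (1 : ℝ) :=
      (single_eq_single_vecMulVec_single i j).symm
    have := Slides.one_add_smul (n := n) (a := a) (b := b) (x := Pi.single i 1) (y := Pi.single j 1)
      (by rw [e]; exact H i j) c
    rwa [e, smul_single, smul_eq_mul, mul_one] at this
  refine diagonal_transvection_induction (Slides n a b) h (fun D _ => ?_) (fun t => H1 _ _ _)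
    fun A B => Slides.mul
  have key : ∀ s : Finset ι, Slides n a b (diagonal fun i => if i ∈ s then D i else 1) := by
    intro s
    induction s using Finset.induction_on with
    | empty => simpa using Slides.one
    | insert i s hi ih =>
      convert ih.mul (H1 i i (D i - 1)) using 1
      rw [Matrix.mul_add, Matrix.mul_one]
      ext k l
      simp only [diagonal_apply, add_apply, diagonal_mul, single_apply, Finset.mem_insert]
      by_cases hk : k = l
      · subst hk
        by_cases hki : k = i
        · subst hki; simp [hi]
        · simp [hki, Ne.symm hki]
      · have : ¬ (i = k ∧ i = l) := fun h => hk (h.1.symm.trans h.2)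
        simp [hk, this]
  simpa using key Finset.univ

end Slides

/-! ### Equality of two averages -/

section Average

variable {K₁ K₂ ι : Type*} [Fintype K₁] [Fintype K₂] [Fintype ι] [DecidableEq ι]
variable {n : Type*} [Fintype n] [DecidableEq n]

/-- Both sides equal the double sum over the products `a₂ l * a₁ k` and `b₁ k * b₂ l`, as in the
uniqueness of Haar measure. For fixed `l`, insert `a₂ l * b₂ l = 1` and slide `b₂ l` through the
first family; for fixed `k`, insert `b₁ k * a₁ k = 1` and slide `b₁ k` through the second, in which
the roles of `a` and `b` are exchanged. -/
theorem card_mul_sum_det_eq {a₁ b₁ : K₁ → Matrix ι ι ℝ} {a₂ b₂ : K₂ → Matrix ι ι ℝ}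
    (H₁ : ∀ h, Slides n a₁ b₁ h) (H₂ : ∀ h, Slides n b₂ a₂ h) (h₁ : ∀ k, b₁ k * a₁ k = 1)
    (h₂ : ∀ k, a₂ k * b₂ k = 1) (M : Matrix n n ℝ) (P : Matrix n ι ℝ) (Q : Matrix ι n ℝ)
    (P' : Matrix n ι ℝ) (Q' : Matrix ι n ℝ) :
    Fintype.card K₂ * ∑ k, (M + P * a₁ k * Q + P' * b₁ k * Q').det =
      Fintype.card K₁ * ∑ k, (M + P * a₂ k * Q + P' * b₂ k * Q').det := by
  have e1 : ∀ l, ∑ k, (M + P * a₁ k * Q + P' * b₁ k * Q').det =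
      ∑ k, (M + P * (a₂ l * a₁ k) * Q + P' * (b₁ k * b₂ l) * Q').det := by
    intro l
    have := H₁ (b₂ l) M (P * a₂ l) Q P' Q'
    have e : ∀ k, P * a₂ l * (b₂ l * a₁ k) * Q = P * a₁ k * Q := by
      intro k
      rw [Matrix.mul_assoc P, ← Matrix.mul_assoc (a₂ l), h₂, Matrix.one_mul]
    simp only [e] at this
    simpa only [Matrix.mul_assoc] using this
  have e2 : ∀ k, ∑ l, (M + P * a₂ l * Q + P' * b₂ l * Q').det =
      ∑ l, (M + P * (a₂ l * a₁ k) * Q + P' * (b₁ k * b₂ l) * Q').det := by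
    intro k
    have := (H₂ (b₁ k) M P' Q' P (a₁ k * Q)).symm
    have e : ∀ l, P * (a₂ l * b₁ k) * (a₁ k * Q) = P * a₂ l * Q := by
      intro l
      rw [← Matrix.mul_assoc, Matrix.mul_assoc P, Matrix.mul_assoc (a₂ l), h₁, Matrix.mul_one]
    simp only [e] at this
    simp only [add_right_comm M] at this ⊢
    simpa only [Matrix.mul_assoc] using this
  rw [← nsmul_eq_mul, ← nsmul_eq_mul, ← Finset.card_univ, ← Finset.card_univ, ← Finset.sum_const,
    ← Finset.sum_const, Finset.sum_congr rfl fun l _ => e1 l, Finset.sum_congr rfl fun k _ => e2 k,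
    Finset.sum_comm]

end Average

end Matrix

/-! ### The standard representation of the symmetric group and signed permutations -/

namespace Matrix

section Standard

variable {d : ℕ}

/-- The matrix of the permutation `σ` of `Fin (d + 1)` on the vectors of sum zero, in the basis
`e_{i+1} - e_0`. -/
def stdPerm (σ : Equiv.Perm (Fin (d + 1))) : Matrix (Fin d) (Fin d) ℝ :=
  of fun i j => (if σ j.succ = i.succ then 1 else 0) - (if σ 0 = i.succ then 1 else 0)

theorem stdPerm_mul (σ τ : Equiv.Perm (Fin (d + 1))) :
    stdPerm (σ * τ) = stdPerm σ * stdPerm τ := by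
  ext i k
  have key : ∀ u : Fin (d + 1) → ℝ, u 0 = 0 → ∀ x,
      ∑ j : Fin d, u j.succ * (if x = j.succ then 1 else 0) = u x := by
    intro u hu x
    have h : ∑ j : Fin (d + 1), u j * (if x = j then 1 else 0) = u x := by simp
    rw [Fin.sum_univ_succ, hu, zero_mul, zero_add] at h
    exact h
  have h := fun x => key
    (fun x => (if σ x = i.succ then 1 else 0) - (if σ 0 = i.succ then 1 else 0)) (sub_self _) x
  simp only [mul_apply, stdPerm, of_apply, mul_sub (_ - _ : ℝ), Finset.sum_sub_distrib, h,
    Equiv.Perm.mul_apply]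
  rw [sub_sub_sub_cancel_right]
  by_cases h1 : σ (τ k.succ) = i.succ <;> by_cases h2 : σ (τ 0) = i.succ <;> simp [h1, h2]

theorem stdPerm_one : stdPerm (1 : Equiv.Perm (Fin (d + 1))) = 1 := by
  ext i j
  simp [stdPerm, one_apply, (Fin.succ_ne_zero _).symm, eq_comm]

theorem stdPerm_inv_mul (σ : Equiv.Perm (Fin (d + 1))) : stdPerm σ⁻¹ * stdPerm σ = 1 := by
  rw [← stdPerm_mul, inv_mul_cancel, stdPerm_one]

theorem stdPerm_swap_zero (i : Fin d) :
    stdPerm (Equiv.swap 0 i.succ) = 1 + vecMulVec (-Pi.single i 1) (1 + Pi.single i 1) := by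
  ext k j
  simp only [stdPerm, of_apply, Equiv.swap_apply_left, Fin.succ_inj, add_apply, one_apply,
    vecMulVec_apply, Pi.neg_apply, Pi.add_apply, Pi.one_apply]
  rcases eq_or_ne j i with rfl | hj
  · rcases eq_or_ne k j with rfl | hk
    · simp [(Fin.succ_ne_zero _).symm]
    · simp [(Fin.succ_ne_zero _).symm, hk, hk.symm]
  · rw [Equiv.swap_apply_of_ne_of_ne (Fin.succ_ne_zero _) (by simpa using hj)]
    rcases eq_or_ne k i with rfl | hk
    · simp [hj, hj.symm]
    · simp [hk, hj, hk.symm, eq_comm]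

variable {n : Type*} [Fintype n] [DecidableEq n]

/-- The transpositions `(0 i+1)` act as the reflections `1 - e_i (1 + e_i)ᵀ`. The rank-one parts of
these and of their conjugates span all matrices. -/
theorem slides_stdPerm (h : Matrix (Fin d) (Fin d) ℝ) :
    Slides n (fun σ : Equiv.Perm (Fin (d + 1)) => stdPerm σ) (fun σ => stdPerm σ⁻¹) h := by
  have h0 : ∀ τ : Equiv.Perm (Fin (d + 1)),
      Slides n (fun σ => stdPerm σ) (fun σ => stdPerm σ⁻¹) (stdPerm τ) := by
    intro τ
    refine slides_of_equiv (Equiv.mulLeft τ⁻¹) _ (fun k => ?_) fun k => ?_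
    · rw [← stdPerm_mul]; simp
    · rw [← stdPerm_mul]; simp
  set g := slideLie n (fun σ : Equiv.Perm (Fin (d + 1)) => stdPerm σ) (fun σ => stdPerm σ⁻¹) with hg
  have h1 : ∀ i : Fin d, vecMulVec (Pi.single i 1) (1 + Pi.single i 1) ∈ g := by
    intro i
    have := h0 (Equiv.swap 0 i.succ)
    rw [stdPerm_swap_zero, slides_one_add_vecMulVec_iff, neg_vecMulVec] at this
    exact (Submodule.neg_mem_iff _).1 this
  have h2 : ∀ i j : Fin d, i ≠ j → vecMulVec (Pi.single i 1) (1 + Pi.single j 1) -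
      (1 / 3 : ℝ) • vecMulVec (Pi.single j 1) (1 + Pi.single i 1) ∈ g := by
    intro i j hij
    -- With `s = 1` and `y ⬝ᵥ x = 2` the conjugate is `(e_j + e_i) ((1 + e_j) - (1 + e_i)/3)ᵀ`.
    have := vecMulVec_conj_rankOne (h1 i) (h1 j) 1 (by simp; norm_num)
    simp only [dotProduct_single, Pi.add_apply, Pi.one_apply, Pi.single_eq_same,
      Pi.single_eq_of_ne hij, Pi.single_eq_of_ne hij.symm, one_mul, mul_one, add_zero] at this
    have h3 := g.sub_mem (g.add_mem this (g.smul_mem (1 / 3) (h1 i))) (h1 j)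
    convert h3 using 1
    ext a b
    simp only [sub_apply, add_apply, smul_apply, vecMulVec_apply, Pi.add_apply, Pi.sub_apply,
      Pi.smul_apply, smul_eq_mul]
    ring
  have h3 : ∀ i j : Fin d, vecMulVec (Pi.single i 1) (1 + Pi.single j 1) ∈ g := by
    intro i j
    rcases eq_or_ne i j with rfl | hij
    · exact h1 i
    -- Solving the two relations for `(i, j)` and `(j, i)`, with determinant `1 - 1/9 = 8/9`.
    · have := g.smul_mem (9 / 8) (g.add_mem (h2 i j hij) (g.smul_mem (1 / 3) (h2 j i hij.symm)))
      convert this using 1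
      ext a b
      simp only [sub_apply, add_apply, smul_apply, smul_eq_mul]
      ring
  refine slides_of_single_mem (fun i j => ?_) h
  -- The vectors `1 + e_k` sum to `(d + 1) • 1`, so subtracting their mean from `1 + e_j` leaves
  -- `e_j`.
  have := g.sub_mem (h3 i j) (g.smul_mem (1 / (d + 1)) (g.sum_mem fun k (_ : k ∈ Finset.univ) =>
    h3 i k))
  convert this using 1
  ext a b
  simp only [sub_apply, smul_apply, sum_apply, vecMulVec_apply, Pi.add_apply, Pi.one_apply,
    smul_eq_mul, ← Finset.mul_sum, Finset.sum_add_distrib, Finset.sum_const, Finset.card_univ,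
    Fintype.card_fin, nsmul_eq_mul, mul_one, single_apply, Pi.single_apply, Finset.sum_ite_eq,
    Finset.mem_univ, if_true]
  have hd : (d : ℝ) + 1 ≠ 0 := by positivity
  field_simp
  rcases eq_or_ne i a with rfl | hia <;> rcases eq_or_ne j b with rfl | hjb <;>
    simp_all [eq_comm]

end Standard

/-! ### Signed permutation matrices -/

section Signed

variable {ι : Type*} [DecidableEq ι]

/-- The signed permutation matrix with the signs `k.1` and the permutation `k.2`. -/
def signedPerm (k : (ι → ℤˣ) × Equiv.Perm ι) : Matrix ι ι ℝ :=
  of fun i j => if i = k.2 j then ((k.1 i : ℤ) : ℝ) else 0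

variable [Fintype ι]

theorem signedPerm_transpose_mul (k : (ι → ℤˣ) × Equiv.Perm ι) :
    (signedPerm k)ᵀ * signedPerm k = 1 := by
  ext i j
  simp only [mul_apply, transpose_apply, signedPerm, of_apply, ite_mul, zero_mul, mul_ite, mul_zero,
    Finset.sum_ite_eq', Finset.mem_univ, if_true, one_apply, EmbeddingLike.apply_eq_iff_eq]
  rcases eq_or_ne i j with rfl | hij
  · rcases Int.units_eq_one_or (k.1 (k.2 i)) with h | h <;> simp [h]
  · simp [hij, hij.symm]

variable {n : Type*} [Fintype n] [DecidableEq n]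

/-- The reflections are now the sign changes `1 - 2 e_i e_iᵀ` and the transpositions `1 - (e_i -
e_j)(e_i - e_j)ᵀ`; again their rank-one parts and conjugates of these span all matrices. -/
theorem slides_signedPerm (h : Matrix ι ι ℝ) :
    Slides n (fun k : (ι → ℤˣ) × Equiv.Perm ι => signedPerm k) (fun k => (signedPerm k)ᵀ) h := by
  set g := slideLie n (fun k : (ι → ℤˣ) × Equiv.Perm ι => signedPerm k)
    (fun k => (signedPerm k)ᵀ) with hg
  have h1 : ∀ i : ι, vecMulVec (Pi.single i 1) (Pi.single i 1) ∈ g := by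
    intro i
    have : Slides n (fun k : (ι → ℤˣ) × Equiv.Perm ι => signedPerm k) (fun k => (signedPerm k)ᵀ)
        (1 + vecMulVec (-(2 : ℝ) • Pi.single i 1) (Pi.single i 1)) := by
      have e : (1 + vecMulVec (-(2 : ℝ) • Pi.single i 1) (Pi.single i 1) : Matrix ι ι ℝ) =
          diagonal fun j => if j = i then -1 else 1 := by
        ext a b
        rcases eq_or_ne a b with rfl | hab
        · rcases eq_or_ne a i with rfl | hai
          · simp [vecMulVec_apply]; norm_num
          · simp [vecMulVec_apply, hai]
        · rcases eq_or_ne a i with rfl | hai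
          · simp [vecMulVec_apply, hab, hab.symm]
          · simp [vecMulVec_apply, hai, hab]
      rw [e]
      let δ : ι → ℤˣ := fun j => if j = i then -1 else 1
      have hδ : ∀ j, (if j = i then (-1 : ℝ) else 1) = ((δ j : ℤ) : ℝ) := by
        intro j; simp only [δ]; split_ifs <;> simp
      simp only [hδ]
      have hδ2 : ∀ j, ((δ j : ℤ) : ℝ) * ((δ j : ℤ) : ℝ) = 1 := by
        intro j
        rcases Int.units_eq_one_or (δ j) with h | h <;> simp [h]
      refine slides_of_equiv ((Equiv.mulLeft δ).prodCongr (Equiv.refl _)) _ (fun k => ?_) fun k => ?_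
      · ext a b
        simp [diagonal_mul, signedPerm, ← mul_assoc, hδ2]
      · ext a b
        simp only [mul_diagonal, signedPerm, transpose_apply, of_apply, Equiv.prodCongr_apply,
          Prod.map, Equiv.refl_apply, ite_mul, zero_mul, Equiv.coe_mulLeft, Pi.mul_apply,
          Units.val_mul, Int.cast_mul]
        simp only [mul_comm]
    rw [slides_one_add_vecMulVec_iff, smul_vecMulVec] at this
    exact (Submodule.smul_mem_iff _ (by norm_num)).1 this
  have h2 : ∀ i j : ι, i ≠ j →
      vecMulVec (Pi.single i 1 - Pi.single j 1) (Pi.single i 1 - Pi.single j 1) ∈ g := by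
    intro i j hij
    have : Slides n (fun k : (ι → ℤˣ) × Equiv.Perm ι => signedPerm k) (fun k => (signedPerm k)ᵀ)
        (1 + vecMulVec (-(Pi.single i 1 - Pi.single j 1)) (Pi.single i 1 - Pi.single j 1)) := by
      have e : (1 + vecMulVec (-(Pi.single i 1 - Pi.single j 1)) (Pi.single i 1 - Pi.single j 1) :
          Matrix ι ι ℝ) = of fun a b => if a = Equiv.swap i j b then 1 else 0 := by
        ext a b
        simp only [add_apply, one_apply, vecMulVec_apply, Pi.neg_apply, Pi.sub_apply,
          Pi.single_apply, of_apply, Equiv.swap_apply_def]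
        by_cases h1 : a = i <;> by_cases h2 : a = j <;> by_cases h3 : b = i <;>
          by_cases h4 : b = j <;> simp_all
      rw [e]
      refine slides_of_equiv
        ((Equiv.arrowCongr (Equiv.swap i j) (Equiv.refl _)).prodCongr
          (Equiv.mulLeft (Equiv.swap i j))) _ (fun k => ?_) fun k => ?_
      · ext a b
        simp only [mul_apply, of_apply, signedPerm, ite_mul, zero_mul, one_mul]
        rw [Finset.sum_eq_single (Equiv.swap i j a)]
        · simp
        · intro c _ hc
          rw [if_neg]
          rintro rfl
          simp at hc
        · simp
      · ext a b
        simp only [mul_apply, of_apply, signedPerm, transpose_apply, mul_ite, mul_zero, mul_one]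
        rw [Finset.sum_eq_single (Equiv.swap i j b)]
        · simp [Equiv.swap_apply_eq_iff]
        · intro c _ hc
          rw [if_neg]
          exact hc
        · simp
    rw [slides_one_add_vecMulVec_iff, neg_vecMulVec] at this
    exact (Submodule.neg_mem_iff _).1 this
  have h3 : ∀ i j : ι, i ≠ j → (2 : ℝ) • vecMulVec (Pi.single i 1) (Pi.single j 1) +
      (1 / 2 : ℝ) • vecMulVec (Pi.single j 1) (Pi.single i 1) ∈ g := by
    intro i j hij
    -- The conjugate is `(2 e_i - e_j)(e_i/2 - e_j)ᵀ`.
    have := vecMulVec_conj_rankOne (h1 i) (h2 i j hij) 1 (by simp)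
    simp only [dotProduct_sub, sub_dotProduct, single_dotProduct, Pi.single_eq_same,
      Pi.single_eq_of_ne hij, Pi.single_eq_of_ne hij.symm, one_mul, mul_one, sub_zero] at this
    have h4 := g.sub_mem (g.add_mem (h1 i) (h1 j)) this
    convert h4 using 1
    ext a b
    simp only [sub_apply, add_apply, smul_apply, vecMulVec_apply, Pi.add_apply, Pi.sub_apply,
      Pi.smul_apply, smul_eq_mul]
    ring
  refine slides_of_single_mem (fun i j => ?_) h
  rw [single_eq_single_vecMulVec_single]
  rcases eq_or_ne i j with rfl | hij
  · exact h1 i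
  -- `E_ji` is eliminated between the relations for `(i, j)` and `(j, i)`, which leaves `(4 - 1/4)
  -- E_ij = (15/4) E_ij`.
  · have := g.smul_mem (4 / 15) (g.sub_mem (g.smul_mem 2 (h3 i j hij))
      (g.smul_mem (1 / 2) (h3 j i hij.symm)))
    convert this using 1
    ext a b
    simp only [sub_apply, add_apply, smul_apply, smul_eq_mul]
    ring

end Signed

end Matrix

/-! ### Replacing averages coordinate by coordinate -/

section PiSum

theorem Fintype.sum_option_arrow {α β M : Type*} [Fintype α] [DecidableEq α]
    [DecidableEq (Option α)] [Fintype β]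
    [AddCommMonoid M] (g : (Option α → β) → M) :
    ∑ k, g k = ∑ b, ∑ k : α → β, g (fun o => o.elim b k) := by
  rw [← Fintype.sum_prod_type', ← (Equiv.piOptionEquivProd (β := fun _ : Option α => β)).symm.sum_comp]
  refine Finset.sum_congr rfl fun k _ => congrArg g ?_
  ext o
  cases o <;> rfl

/-- A hybrid argument: the coordinates are switched from the first family to the second one at a
time, by induction on `E`. -/
theorem Fintype.sum_comp_eq_of_sum_update_eq {X K₁ K₂ : Type*} [Fintype K₁] [Fintype K₂]
    (x₁ : K₁ → X) (x₂ : K₂ → X) (c₁ c₂ : ℝ) (E : Type*) [Fintype E] [DecidableEq E]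
    (f : (E → X) → ℝ)
    (h : ∀ e y, c₂ * ∑ k, f (Function.update y e (x₁ k)) =
      c₁ * ∑ k, f (Function.update y e (x₂ k))) :
    c₂ ^ Fintype.card E * ∑ k : E → K₁, f (x₁ ∘ k) =
      c₁ ^ Fintype.card E * ∑ k : E → K₂, f (x₂ ∘ k) := by
  revert f
  suffices H : ∀ [DecidableEq E] (f : (E → X) → ℝ),
      (∀ e y, c₂ * ∑ k, f (Function.update y e (x₁ k)) =
        c₁ * ∑ k, f (Function.update y e (x₂ k))) →
      c₂ ^ Fintype.card E * ∑ k : E → K₁, f (x₁ ∘ k) =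
        c₁ ^ Fintype.card E * ∑ k : E → K₂, f (x₂ ∘ k) from fun f => H f
  refine Fintype.induction_empty_option (P := fun E _ => ∀ [DecidableEq E] (f : (E → X) → ℝ),
      (∀ e y, c₂ * ∑ k, f (Function.update y e (x₁ k)) =
        c₁ * ∑ k, f (Function.update y e (x₂ k))) →
      c₂ ^ Fintype.card E * ∑ k : E → K₁, f (x₁ ∘ k) =
        c₁ ^ Fintype.card E * ∑ k : E → K₂, f (x₂ ∘ k)) ?_ ?_ ?_ E
  · intro α β _ φ ih
    classical
    intro _ f hf
    let _ : Fintype α := Fintype.ofEquiv β φ.symm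
    have h' := ih (fun y => f (y ∘ φ.symm)) (fun e y => by
      have := hf (φ e) (y ∘ φ.symm)
      have hu : ∀ b, Function.update y e b ∘ φ.symm = Function.update (y ∘ φ.symm) (φ e) b := by
        intro b
        ext z
        by_cases hz : z = φ e
        · subst hz; simp
        · have : φ.symm z ≠ e := fun h => hz (by rw [← h]; simp)
          simp [hz, this]
      simp only [hu]
      exact this)
    rw [Fintype.card_congr φ] at h'
    rw [← (Equiv.arrowCongr φ (Equiv.refl K₁)).sum_comp, ← (Equiv.arrowCongr φ (Equiv.refl K₂)).sum_comp]
    convert h' using 4 <;> rfl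
  · intro _ f _
    simp only [Fintype.card_pempty, pow_zero, one_mul]
    have : ∀ (y z : PEmpty → X), y = z := fun y z => Subsingleton.elim _ _
    simp only [Fintype.sum_unique]
    exact congrArg f (this _ _)
  · intro α _ ih
    classical
    intro _ f hf
    have hc1 : ∀ (b : K₁) (k : α → K₁), x₁ ∘ (fun o : Option α => o.elim b k) =
        fun o => o.elim (x₁ b) (x₁ ∘ k) := by
      intro b k; ext o; cases o <;> rfl
    have hc2 : ∀ (b : K₂) (k : α → K₂), x₂ ∘ (fun o : Option α => o.elim b k) =
        fun o => o.elim (x₂ b) (x₂ ∘ k) := by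
      intro b k; ext o; cases o <;> rfl
    have hu : ∀ (z : X) (y : α → X) (e : α) (x : X),
        (fun o : Option α => o.elim z (Function.update y e x)) =
          Function.update (fun o : Option α => o.elim z y) (some e) x := by
      intro z y e x
      ext o
      cases o with
      | none => simp
      | some a =>
        by_cases ha : a = e
        · subst ha; simp
        · simp [ha]
    have hn : ∀ (z w : X) (y : α → X), (fun o : Option α => o.elim z y) =
        Function.update (fun o : Option α => o.elim w y) none z := by
      intro z w y
      ext o
      cases o <;> simp
    have ih' : ∀ b : K₁, c₂ ^ Fintype.card α * ∑ k : α → K₁, f (fun o => o.elim (x₁ b) (x₁ ∘ k)) =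
        c₁ ^ Fintype.card α * ∑ k : α → K₂, f (fun o => o.elim (x₁ b) (x₂ ∘ k)) := fun b =>
      ih (fun y => f (fun o => o.elim (x₁ b) y)) (fun e y => by
        simp only [hu]
        exact hf _ _)
    have h2 : ∀ k : α → K₂, c₂ * ∑ b, f (fun o => o.elim (x₁ b) (x₂ ∘ k)) =
        c₁ * ∑ b, f (fun o => o.elim (x₂ b) (x₂ ∘ k)) := by
      intro k
      rcases isEmpty_or_nonempty X with hX | ⟨⟨w⟩⟩
      · have e1 : IsEmpty K₁ := ⟨fun b => hX.elim (x₁ b)⟩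
        have e2 : IsEmpty K₂ := ⟨fun b => hX.elim (x₂ b)⟩
        simp
      · have e := hf none (fun o => o.elim w (x₂ ∘ k))
        simp only [← hn _ w] at e
        exact e
    rw [Fintype.card_option, Fintype.sum_option_arrow, Fintype.sum_option_arrow]
    simp only [hc1, hc2]
    calc _ = c₂ * ∑ b, c₂ ^ Fintype.card α * ∑ k : α → K₁, f (fun o => o.elim (x₁ b) (x₁ ∘ k)) := by
          rw [pow_succ', mul_assoc, Finset.mul_sum]
      _ = c₁ ^ Fintype.card α * ∑ k : α → K₂, c₂ * ∑ b, f (fun o => o.elim (x₁ b) (x₂ ∘ k)) := by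
          simp only [ih', ← Finset.mul_sum]
          rw [Finset.sum_comm]
          ring
      _ = _ := by
          simp only [h2, ← Finset.mul_sum]
          rw [Finset.sum_comm]
          ring

end PiSum

/-! ### Permutation coverings and their adjacency matrices -/

namespace MultiGraph

open Matrix

section PermCover

variable {V E ι : Type*} (G : MultiGraph V E)

/-- The covering of `G` with fibre `ι` in which the lift of `e` starting at `(src e, i)` ends at
`(tgt e, σ e i)`. -/
def permCover (σ : E → Equiv.Perm ι) : MultiGraph (V × ι) (E × ι) where
  src f := (G.src f.1, f.2)
  tgt f := (G.tgt f.1, σ f.1 f.2)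

/-- The projection of a permutation covering. -/
def permCoverHom (σ : E → Equiv.Perm ι) : Hom (G.permCover σ) G where
  onVert := Prod.fst
  onDart d := (d.1.1, d.2)
  tail_onDart := by
    rintro ⟨⟨e, i⟩, _ | _⟩ <;> rfl
  onDart_rev := fun _ => rfl

theorem permCoverHom_bijOn (σ : E → Equiv.Perm ι) (w : V × ι) :
    Set.BijOn (G.permCoverHom σ).onDart {d | (G.permCover σ).tail d = w}
      {d | G.tail d = (G.permCoverHom σ).onVert w} := by
  refine ⟨?_, ?_, ?_⟩
  · rintro d rfl
    exact (G.permCoverHom σ).tail_onDart d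
  · rintro ⟨⟨e, i⟩, b⟩ h1 ⟨⟨e', i'⟩, b'⟩ h2 h
    obtain ⟨rfl, rfl⟩ : e = e' ∧ b = b' := by
      simpa [permCoverHom] using h
    have h3 := (congrArg Prod.snd h1).trans (congrArg Prod.snd h2).symm
    cases b <;> simpa [tail, permCover] using h3
  · rintro ⟨e, b⟩ hd
    cases b
    · refine ⟨((e, (σ e).symm w.2), false), ?_, rfl⟩
      exact Prod.ext hd (by simp [tail, permCover])
    · exact ⟨((e, w.2), true), Prod.ext hd rfl, rfl⟩

theorem permCoverHom_isCovering {r : ℕ} (σ : E → Equiv.Perm (Fin r)) :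
    (G.permCoverHom σ).IsCovering r where
  bijOn := G.permCoverHom_bijOn σ
  encard_fiber v := by
    have : {w : V × Fin r | (G.permCoverHom σ).onVert w = v} = Set.range fun i => (v, i) := by
      ext ⟨a, i⟩
      simp [permCoverHom, eq_comm]
    rw [this, ← Set.image_univ, Function.Injective.encard_image (fun i j h => by simpa using h)]
    simp

end PermCover

section SignAdj

variable {W F : Type*} [Fintype F] [DecidableEq W] (H : MultiGraph W F)

/-- The adjacency matrix of a signed graph. -/
def signAdj (s : F → ℤˣ) : Matrix W W ℝ :=
  ∑ f, ((s f : ℤ) : ℝ) • (single (H.src f) (H.tgt f) 1 + single (H.tgt f) (H.src f) 1)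

theorem adjMatrix_eq_sum :
    H.adjMatrix = ∑ f, (single (H.src f) (H.tgt f) 1 + single (H.tgt f) (H.src f) 1) := by
  ext u v
  rw [adjMatrix, of_apply, Finset.card_filter, Fintype.sum_prod_type]
  push_cast
  simp only [tail, head, Matrix.sum_apply, Matrix.add_apply, single_apply, Fintype.sum_bool,
    cond_true, cond_false]
  congr!

end SignAdj

section TwistAdj

variable {V E ι : Type*} [Fintype E] [Fintype ι] [DecidableEq V] [DecidableEq ι]
  (G : MultiGraph V E)

/-- The inclusion of the fibre over `u`, as a matrix. -/
def fibreMatrix (ι : Type*) [DecidableEq ι] (u : V) : Matrix (V × ι) ι ℝ :=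
  of fun w j => if w = (u, j) then 1 else 0

/-- The adjacency matrix twisted by the matrices `(x e).2` along `e` and `(x e).1` along the
reverse of `e`. -/
def twistAdj (x : E → Matrix ι ι ℝ × Matrix ι ι ℝ) : Matrix (V × ι) (V × ι) ℝ :=
  ∑ e, (fibreMatrix ι (G.tgt e) * (x e).1 * (fibreMatrix ι (G.src e))ᵀ +
    fibreMatrix ι (G.src e) * (x e).2 * (fibreMatrix ι (G.tgt e))ᵀ)

theorem fibreMatrix_mul_mul (u v : V) (a : Matrix ι ι ℝ) (p q : V × ι) :
    (fibreMatrix ι u * a * (fibreMatrix ι v)ᵀ) p q =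
      if p.1 = u ∧ q.1 = v then a p.2 q.2 else 0 := by
  simp only [fibreMatrix, mul_apply, of_apply, transpose_apply, ite_mul, one_mul, zero_mul,
    mul_ite, mul_one, mul_zero]
  by_cases hp : p.1 = u
  · by_cases hq : q.1 = v
    · subst hp hq
      rw [if_pos ⟨rfl, rfl⟩, Finset.sum_eq_single q.2, if_pos rfl, Finset.sum_eq_single p.2,
        if_pos rfl]
      · exact fun b _ hb => if_neg fun h => hb (congrArg Prod.snd h).symm
      · simp
      · exact fun b _ hb => if_neg fun h => hb (congrArg Prod.snd h).symm
      · simp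
    · rw [if_neg fun h => hq h.2]
      exact Finset.sum_eq_zero fun b _ => if_neg fun h => hq (congrArg Prod.fst h)
  · rw [if_neg fun h => hp h.1]
    refine Finset.sum_eq_zero fun b _ => ?_
    rw [Finset.sum_eq_zero, ite_self]
    exact fun c _ => if_neg fun h => hp (congrArg Prod.fst h)

theorem twistAdj_apply (x : E → Matrix ι ι ℝ × Matrix ι ι ℝ) (p q : V × ι) :
    G.twistAdj x p q = ∑ e, ((if p.1 = G.tgt e ∧ q.1 = G.src e then (x e).1 p.2 q.2 else 0) +
      if p.1 = G.src e ∧ q.1 = G.tgt e then (x e).2 p.2 q.2 else 0) := by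
  simp only [twistAdj, Matrix.sum_apply, Matrix.add_apply, fibreMatrix_mul_mul]

/-- The permutation enters inverted because `signedPerm` stands on the reversed edge, from the
target fibre to the source fibre. The signs are therefore indexed by the source fibre, as the lifts
of `e` are in `permCover`. -/
theorem twistAdj_signedPerm (k : E → (ι → ℤˣ) × Equiv.Perm ι) :
    G.twistAdj (fun e => ((signedPerm (k e))ᵀ, signedPerm (k e))) =
      (G.permCover fun e => (k e).2⁻¹).signAdj fun f => (k f.1).1 f.2 := by
  ext p q
  rw [twistAdj_apply, signAdj, Matrix.sum_apply, Fintype.sum_prod_type]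
  refine Finset.sum_congr rfl fun e _ => ?_
  simp only [Matrix.smul_apply, Matrix.add_apply, single_apply, permCover, mul_add, Finset.sum_add_distrib,
    smul_eq_mul, mul_ite, mul_one, mul_zero, transpose_apply, signedPerm, of_apply]
  rw [add_comm]
  congr 1
  · rw [Finset.sum_eq_single p.2]
    · obtain ⟨p1, p2⟩ := p
      obtain ⟨q1, q2⟩ := q
      simp only [Prod.mk.injEq, and_true, Equiv.Perm.inv_eq_iff_eq, ← ite_and]
      refine if_congr ?_ rfl rfl
      grind
    · intro i _ hi
      exact if_neg fun h => hi (congrArg Prod.snd h.1)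
    · simp
  · rw [Finset.sum_eq_single q.2]
    · obtain ⟨p1, p2⟩ := p
      obtain ⟨q1, q2⟩ := q
      simp only [Prod.mk.injEq, and_true, Equiv.Perm.inv_eq_iff_eq, ← ite_and]
      refine if_congr ?_ rfl rfl
      grind
    · intro i _ hi
      exact if_neg fun h => hi (congrArg Prod.snd h.2)
    · simp

variable [Fintype V] [DecidableEq E]

-- Isolates one edge, in the shape `M + P a Q + P' b Q'` required by `card_mul_sum_det_eq`.
omit [Fintype V] in
theorem twistAdj_update (x : E → Matrix ι ι ℝ × Matrix ι ι ℝ) (e : E)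
    (y : Matrix ι ι ℝ × Matrix ι ι ℝ) (N : Matrix (V × ι) (V × ι) ℝ) :
    N - G.twistAdj (Function.update x e y) =
      (N - ∑ e' ∈ Finset.univ.erase e, (fibreMatrix ι (G.tgt e') * (x e').1 *
        (fibreMatrix ι (G.src e'))ᵀ + fibreMatrix ι (G.src e') * (x e').2 *
          (fibreMatrix ι (G.tgt e'))ᵀ)) +
      (-fibreMatrix ι (G.tgt e)) * y.1 * (fibreMatrix ι (G.src e))ᵀ +
      (-fibreMatrix ι (G.src e)) * y.2 * (fibreMatrix ι (G.tgt e))ᵀ := by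
  rw [twistAdj, ← Finset.add_sum_erase _ _ (Finset.mem_univ e), Function.update_self]
  have : ∀ e' ∈ Finset.univ.erase e, Function.update x e y e' = x e' := fun e' he' =>
    Function.update_of_ne (Finset.ne_of_mem_erase he') _ _
  rw [Finset.sum_congr rfl fun e' he' => by rw [this e' he']]
  simp only [Matrix.neg_mul]
  abel

/-- The average of the characteristic polynomials of the new parts of the `(d + 1)`-sheeted
permutation coverings of `G` is that of the signed `d`-sheeted permutation coverings. -/
theorem sum_det_stdPerm_eq_sum_det_signAdj (d : ℕ) (t : ℝ) :
    (Fintype.card ((Fin d → ℤˣ) × Equiv.Perm (Fin d)) : ℝ) ^ Fintype.card E *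
      ∑ σ : E → Equiv.Perm (Fin (d + 1)),
        (t • 1 - G.twistAdj fun e => (stdPerm (σ e), stdPerm (σ e)⁻¹)).det =
    (Fintype.card (Equiv.Perm (Fin (d + 1))) : ℝ) ^ Fintype.card E *
      ∑ σ : E → Equiv.Perm (Fin d), ∑ s : E × Fin d → ℤˣ,
        (t • 1 - (G.permCover σ).signAdj s).det := by
  have h := Fintype.sum_comp_eq_of_sum_update_eq
    (fun σ : Equiv.Perm (Fin (d + 1)) => (stdPerm σ, stdPerm σ⁻¹))
    (fun k : (Fin d → ℤˣ) × Equiv.Perm (Fin d) => ((signedPerm k)ᵀ, signedPerm k))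
    (Fintype.card (Equiv.Perm (Fin (d + 1))))
    (Fintype.card ((Fin d → ℤˣ) × Equiv.Perm (Fin d))) E
    (fun x => (t • 1 - G.twistAdj x).det) (fun e y => by
      simp only [twistAdj_update]
      exact card_mul_sum_det_eq slides_stdPerm slides_signedPerm stdPerm_inv_mul
        signedPerm_transpose_mul _ _ _ _ _)
  simp only [Function.comp_def, twistAdj_signedPerm] at h
  rw [h]
  congr 1
  rw [← Fintype.sum_prod_type', ← Equiv.sum_comp (
    (((Equiv.inv _).prodCongr (Equiv.curry _ _ _)).trans ((Equiv.prodComm _ _).trans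
      (Equiv.arrowProdEquivProdArrow E (fun _ => _) (fun _ => _)).symm)))]
  refine Finset.sum_congr rfl fun i _ => ?_
  have : (fun e => (i.1⁻¹ e)⁻¹) = i.1 := by ext; simp
  rw [← this]
  rfl

end TwistAdj

end MultiGraph

/-! ### Averages of determinants over signings -/

namespace Matrix

variable {W : Type*} [DecidableEq W]

/-- The matrix that agrees with `M` on `K × K` and with the identity elsewhere. -/
def restrictTo (M : Matrix W W ℝ) (K : Finset W) : Matrix W W ℝ :=
  of fun x y => if x ∈ K ∧ y ∈ K then M x y else if x = y then 1 else 0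

theorem restrictTo_row (M : Matrix W W ℝ) {K : Finset W} {v : W} (hv : v ∉ K) :
    M.restrictTo K v = Pi.single v 1 := by
  ext y
  simp [restrictTo, hv, Pi.single_apply, eq_comm]

variable [Fintype W]

theorem adjugate_restrictTo_self (M : Matrix W W ℝ) (K : Finset W) (x : W) :
    (M.restrictTo K).adjugate x x = (M.restrictTo (K.erase x)).det := by
  refine adjugate_apply_self_of_row _ _ _ (M.restrictTo_row (Finset.notMem_erase x K)) ?_
  intro i j hi hj
  simp [restrictTo, hi, hj]

theorem det_restrictTo (M : Matrix W W ℝ) {K : Finset W} {v : W} (hv : v ∈ K) :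
    (M.restrictTo K).det = M v v * (M.restrictTo (K.erase v)).det -
      ∑ x ∈ K.erase v, ∑ y ∈ K.erase v,
        M x v * M v y * (M.restrictTo (K.erase v)).adjugate y x := by
  have h := det_updateRow_updateCol _ v (M.restrictTo_row (Finset.notMem_erase v K))
    (fun y => if y ∈ K then M v y else 0) (fun x => if x ∈ K then M x v else 0)
  have e : ((M.restrictTo (K.erase v)).updateRow v (fun y => if y ∈ K then M v y else 0)).updateCol v
      (fun x => if x ∈ K then M x v else 0) = M.restrictTo K := by
    ext x y
    simp only [updateCol_apply, updateRow_apply, restrictTo, of_apply, Finset.mem_erase]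
    by_cases hx : x = v <;> by_cases hy : y = v
    · subst hx hy; simp [hv]
    · subst hx
      have : ¬ x = y := fun h => hy h.symm
      simp [hv, hy, this]
    · subst hy
      simp [hv, hx]
    · simp [hx, hy]
  rw [e] at h
  rw [h, if_pos hv]
  congr 1
  have hsub : K.erase v ⊆ Finset.univ.erase v := Finset.erase_subset_erase v (Finset.subset_univ K)
  have hnot : ∀ x ∈ Finset.univ.erase v, x ∉ K.erase v → x ∉ K := fun x hx hx' hK =>
    hx' (Finset.mem_erase.2 ⟨Finset.ne_of_mem_erase hx, hK⟩)
  rw [← Finset.sum_subset hsub]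
  · refine Finset.sum_congr rfl fun x hx => ?_
    rw [← Finset.sum_subset hsub]
    · refine Finset.sum_congr rfl fun y hy => ?_
      rw [if_pos (Finset.mem_of_mem_erase hx), if_pos (Finset.mem_of_mem_erase hy)]
    · intro y hy hy'
      rw [if_neg (hnot y hy hy')]
      simp
  · intro x hx hx'
    rw [if_neg (hnot x hx hx')]
    simp

end Matrix

namespace MultiGraph

open Matrix

section SignSum

variable {W F : Type*} [Fintype F] [DecidableEq W] (H : MultiGraph W F)

theorem signAdj_apply (s : F → ℤˣ) (x y : W) :
    H.signAdj s x y =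
      ∑ δ : H.Dart, if H.tail δ = x ∧ H.head δ = y then ((s δ.1 : ℤ) : ℝ) else 0 := by
  rw [signAdj, Matrix.sum_apply, Fintype.sum_prod_type]
  simp only [Matrix.smul_apply, Matrix.add_apply, single_apply, Fintype.sum_bool, tail, head,
    cond_true, cond_false, smul_eq_mul, mul_add, mul_ite, mul_one, mul_zero]
  congr!

theorem signAdj_comm (s : F → ℤˣ) (x y : W) : H.signAdj s x y = H.signAdj s y x := by
  simp only [signAdj, Matrix.sum_apply, Matrix.smul_apply, Matrix.add_apply, single_apply]
  refine Finset.sum_congr rfl fun f _ => ?_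
  rw [add_comm]
  simp only [and_comm]

variable [Fintype W]

/-- The sum over all signings of the characteristic polynomials, at `t`, of the signed adjacency
matrices of the subgraph induced on `K`. -/
def signSum [DecidableEq F] (t : ℝ) (K : Finset W) : ℝ :=
  ∑ s : F → ℤˣ, ((t • 1 - H.signAdj s).restrictTo K).det

variable {H}

omit [Fintype W] in
theorem sum_signAdj_mul (s : F → ℤˣ) (v : W) (K : Finset W) (g : W → ℝ) :
    ∑ x ∈ K, H.signAdj s v x * g x =
      ∑ δ : H.Dart with H.tail δ = v ∧ H.head δ ∈ K, ((s δ.1 : ℤ) : ℝ) * g (H.head δ) := by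
  simp only [signAdj_apply, Finset.sum_mul, ite_mul, zero_mul]
  rw [Finset.sum_comm, Finset.sum_filter]
  refine Finset.sum_congr rfl fun δ _ => ?_
  by_cases hv : H.tail δ = v
  · simp [hv]
  · simp [hv]

omit [Fintype F] [DecidableEq W] [Fintype W] in
theorem dart_eq_of_tail_eq (hH : ∀ f, H.src f ≠ H.tgt f) {δ δ' : H.Dart} (h : δ.1 = δ'.1)
    (ht : H.tail δ = H.tail δ') : δ = δ' := by
  obtain ⟨f, b⟩ := δ
  obtain ⟨f', b'⟩ := δ'
  obtain rfl : f = f' := h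
  cases b <;> cases b' <;> simp_all [tail, eq_comm]

/-- Expand along the row and the column of `v`. Averaging over the signs kills the products of two
different edges at `v`, and a repeated edge contributes the square of a sign and a diagonal
cofactor. This is the recursion of the matching polynomial, with parallel edges counted separately.
-/
theorem signSum_eq [DecidableEq F] (hH : ∀ f, H.src f ≠ H.tgt f) (t : ℝ) {K : Finset W} {v : W}
    (hv : v ∈ K) :
    H.signSum t K = t * H.signSum t (K.erase v) -
      ∑ δ : H.Dart with H.tail δ = v ∧ H.head δ ∈ K.erase v,
        H.signSum t ((K.erase v).erase (H.head δ)) := by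
  set D := Finset.univ.filter fun δ : H.Dart => H.tail δ = v ∧ H.head δ ∈ K.erase v with hD
  set N : (F → ℤˣ) → Matrix W W ℝ := fun s => (t • 1 - H.signAdj s).restrictTo (K.erase v) with hN
  have h1 : ∀ s : F → ℤˣ, ((t • 1 - H.signAdj s).restrictTo K).det = t * (N s).det -
      ∑ δ ∈ D, ∑ δ' ∈ D, (((s δ.1 : ℤ) : ℝ) * ((s δ'.1 : ℤ) : ℝ)) *
        (N s).adjugate (H.head δ') (H.head δ) := by
    intro s
    rw [det_restrictTo _ hv]
    congr 2
    · have : H.signAdj s v v = 0 := by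
        rw [signAdj_apply]
        refine Finset.sum_eq_zero fun δ _ => if_neg ?_
        rintro ⟨h1, h2⟩
        obtain ⟨f, b⟩ := δ
        cases b <;> simp [tail, head] at h1 h2
        · exact hH f (h2.trans h1.symm)
        · exact hH f (h1.trans h2.symm)
      simp [this]
    · have e : ∀ x ∈ K.erase v, ∀ y ∈ K.erase v,
          (t • 1 - H.signAdj s) x v * (t • 1 - H.signAdj s) v y * (N s).adjugate y x =
            H.signAdj s v x * (H.signAdj s v y * (N s).adjugate y x) := by
        intro x hx y hy
        simp only [Matrix.sub_apply, Matrix.smul_apply, one_apply,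
          if_neg (Finset.ne_of_mem_erase hx), if_neg (Finset.ne_of_mem_erase hy).symm]
        rw [H.signAdj_comm s x v]
        simp [mul_assoc]
      rw [Finset.sum_congr rfl fun x hx => Finset.sum_congr rfl fun y hy => e x hx y hy]
      simp only [← Finset.mul_sum, sum_signAdj_mul]
      refine Finset.sum_congr rfl fun δ _ => ?_
      rw [Finset.mul_sum]
      exact Finset.sum_congr rfl fun δ' _ => by ring
  have h2 : ∀ δ ∈ D, ∀ δ' ∈ D, δ' ≠ δ → ∑ s : F → ℤˣ, (((s δ.1 : ℤ) : ℝ) * ((s δ'.1 : ℤ) : ℝ)) *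
        (N s).adjugate (H.head δ') (H.head δ) = 0 := by
    intro δ hδ δ' hδ' hne
    have hδ := (Finset.mem_filter.1 hδ).2
    have hδ' := (Finset.mem_filter.1 hδ').2
    have hne1 : δ'.1 ≠ δ.1 := fun h => hne (dart_eq_of_tail_eq hH h (hδ'.1.trans hδ.1.symm))
    -- The edge of `δ` ends at `v`, which the minor on `K.erase v` avoids, so flipping its sign only
    -- changes the sign of the product in front.
    have hN' : ∀ s : F → ℤˣ, N (Pi.mulSingle δ.1 (-1) * s) = N s := by
      intro s
      ext x y
      simp only [hN, restrictTo, of_apply]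
      split_ifs with hxy
      · simp only [Matrix.sub_apply]
        congr 1
        rw [signAdj_apply, signAdj_apply]
        refine Finset.sum_congr rfl fun γ _ => ?_
        split_ifs with hγ
        · have : γ.1 ≠ δ.1 := by
            intro h
            obtain ⟨f, b⟩ := γ
            obtain ⟨f', b'⟩ := δ
            obtain rfl : f = f' := h
            have hx := Finset.ne_of_mem_erase hxy.1
            have hy := Finset.ne_of_mem_erase hxy.2
            cases b <;> cases b' <;> simp_all [tail, head]
          simp [Pi.mulSingle_eq_of_ne this]
        · rfl
      · rfl
      · rfl
    have h3 := Equiv.sum_comp (Equiv.mulLeft (Pi.mulSingle δ.1 (-1) : F → ℤˣ)) fun s =>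
      (((s δ.1 : ℤ) : ℝ) * ((s δ'.1 : ℤ) : ℝ)) * (N s).adjugate (H.head δ') (H.head δ)
    simp only [Equiv.coe_mulLeft, hN', Pi.mul_apply, Pi.mulSingle_eq_same,
      Pi.mulSingle_eq_of_ne hne1, one_mul, Units.val_neg,
      Int.cast_neg, neg_mul, Finset.sum_neg_distrib, neg_eq_self] at h3
    exact h3
  rw [signSum]
  simp only [h1, Finset.sum_sub_distrib]
  rw [← Finset.mul_sum, Finset.sum_comm]
  congr 1
  refine Finset.sum_congr rfl fun δ hδ => ?_
  rw [Finset.sum_comm, Finset.sum_eq_single δ (h2 δ hδ) fun h => absurd hδ h, signSum]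
  refine Finset.sum_congr rfl fun s _ => ?_
  rw [adjugate_restrictTo_self]
  rcases Int.units_eq_one_or (s δ.1) with h | h <;> simp [h]

theorem signSum_empty_pos [DecidableEq F] (t : ℝ) : 0 < H.signSum t ∅ := by
  have : ∀ s : F → ℤˣ, (t • 1 - H.signAdj s).restrictTo ∅ = 1 := by
    intro s
    ext x y
    simp [restrictTo, one_apply]
  simp [signSum, this]

theorem signSum_univ [DecidableEq F] (t : ℝ) :
    H.signSum t Finset.univ = ∑ s : F → ℤˣ, (t • 1 - H.signAdj s).det := by
  refine Finset.sum_congr rfl fun s _ => congrArg det ?_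
  ext x y
  simp [restrictTo]

end SignSum

end MultiGraph

/-! ### Positive supersolutions above the spectral radius -/

/-- Gelfand's formula. -/
theorem spectralRadius_toReal_lt_pow_bound {A : Type*} [NormedRing A] [NormedAlgebra ℂ A]
    [CompleteSpace A] [NormOneClass A] (a : A) {s : ℝ} (hs : (spectralRadius ℂ a).toReal < s) :
    ∀ᶠ n : ℕ in Filter.atTop, ‖a ^ n‖ ≤ s ^ n := by
  have hs0 : 0 ≤ s := ENNReal.toReal_nonneg.trans hs.le
  have h1 : spectralRadius ℂ a < ENNReal.ofReal s := by
    have hfin : spectralRadius ℂ a ≠ ⊤ :=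
      (lt_of_le_of_lt (spectrum.spectralRadius_le_nnnorm a) ENNReal.coe_lt_top).ne
    rw [← ENNReal.ofReal_toReal hfin]
    exact (ENNReal.ofReal_lt_ofReal_iff_of_nonneg ENNReal.toReal_nonneg).2 hs
  filter_upwards [(spectrum.pow_nnnorm_pow_one_div_tendsto_nhds_spectralRadius a).eventually
    (gt_mem_nhds h1), Filter.eventually_gt_atTop 0] with n hn hn0
  have hn0' : (n : ℝ) ≠ 0 := by exact_mod_cast hn0.ne'
  have h2 := ENNReal.rpow_le_rpow hn.le (Nat.cast_nonneg n : (0 : ℝ) ≤ n)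
  rw [← ENNReal.rpow_mul, one_div_mul_cancel hn0', ENNReal.rpow_one, ENNReal.rpow_natCast,
    ← ENNReal.ofReal_pow hs0, ← ENNReal.ofReal_coe_nnreal, coe_nnnorm] at h2
  exact (ENNReal.ofReal_le_ofReal_iff (pow_nonneg hs0 n)).1 h2

namespace SimpleGraph

variable {X : Type*} (T : SimpleGraph X) [T.LocallyFinite]

/-- The number of walks of length `n` from `x` to `o`. -/
noncomputable def walkCount (o : X) : ℕ → X → ℝ
  | 0, x => by classical exact if x = o then 1 else 0
  | n + 1, x => ∑ y ∈ T.neighborFinset x, walkCount o n y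

theorem walkCount_nonneg (o : X) (n : ℕ) (x : X) : 0 ≤ T.walkCount o n x := by
  induction n generalizing x with
  | zero => rw [walkCount]; split_ifs <;> norm_num
  | succ n ih => exact Finset.sum_nonneg fun y _ => ih y

/-- The Green function `f x = ∑ₙ (Aⁿ δ_o)(x) / t^(n+1)` converges for `t` above the spectral radius
and satisfies `A f = t f - δ_o ≤ t f`. It is positive at `o`, and positivity spreads along walks. -/
theorem exists_pos_sum_neighborFinset_le (hT : T.Preconnected) (o : X) (D : ℕ)
    (hD : ∀ x, T.degree x ≤ D) {t : ℝ}
    (ht : (spectralRadius ℂ (T.adjOperator D hD)).toReal < t) :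
    ∃ f : X → ℝ, (∀ x, 0 < f x) ∧ ∀ x, ∑ y ∈ T.neighborFinset x, f y ≤ t * f x := by
  classical
  have ht0 : 0 < t := ENNReal.toReal_nonneg.trans_lt ht
  set A := T.adjOperator D hD with hA
  have : Nonempty X := ⟨o⟩
  have : Nontrivial (lp (fun _ : X => ℂ) 2) := by
    refine ⟨⟨lp.single 2 o 1, 0, fun h => ?_⟩⟩
    have := congrArg (fun g : lp (fun _ : X => ℂ) 2 => g o) h
    simp at this
  have hcount : ∀ n x, (A ^ n) (lp.single 2 o 1) x = (T.walkCount o n x : ℂ) := by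
    intro n
    induction n with
    | zero =>
      intro x
      by_cases hx : x = o
      · subst hx; simp [walkCount]
      · simp [walkCount, hx]
    | succ n ih =>
      intro x
      rw [pow_succ', mul_apply_eq_comp, hA, adjOperator_apply, walkCount,
        Complex.ofReal_sum]
      exact Finset.sum_congr rfl fun y _ => ih y
  obtain ⟨s, hs, hst⟩ := exists_between ht
  have hs0 : 0 ≤ s := ENNReal.toReal_nonneg.trans hs.le
  have hsum : ∀ x, Summable fun n => T.walkCount o n x / t ^ (n + 1) := by
    intro x
    have hgeo : Summable fun n : ℕ => (s / t) ^ n * t⁻¹ :=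
      (summable_geometric_of_lt_one (by positivity) ((div_lt_one ht0).2 hst)).mul_right _
    refine Summable.of_norm_bounded_eventually_nat hgeo ?_
    filter_upwards [spectralRadius_toReal_lt_pow_bound A hs] with n hn
    have h1 : T.walkCount o n x ≤ s ^ n := by
      have h2 := lp.norm_apply_le_norm (p := 2) (by norm_num) ((A ^ n) (lp.single 2 o 1)) x
      rw [hcount, Complex.norm_of_nonneg (T.walkCount_nonneg o n x)] at h2
      refine h2.trans (((A ^ n).le_opNorm _).trans ?_)
      rw [lp.norm_single (by norm_num), norm_one, mul_one]
      exact hn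
    rw [Real.norm_of_nonneg (div_nonneg (T.walkCount_nonneg o n x) (by positivity)), div_pow,
      ← div_eq_mul_inv, div_div, ← pow_succ]
    gcongr
  set f : X → ℝ := fun x => ∑' n, T.walkCount o n x / t ^ (n + 1) with hf
  have hf0 : ∀ x, 0 ≤ f x := fun x =>
    tsum_nonneg fun n => div_nonneg (T.walkCount_nonneg o n x) (by positivity)
  have hle : ∀ x, ∑ y ∈ T.neighborFinset x, f y ≤ t * f x := by
    intro x
    have h1 : f x = T.walkCount o 0 x / t ^ 1 + ∑' n, T.walkCount o (n + 1) x / t ^ (n + 2) :=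
      (hsum x).tsum_eq_zero_add
    have h2 : ∑ y ∈ T.neighborFinset x, f y = t * ∑' n, T.walkCount o (n + 1) x / t ^ (n + 2) := by
      rw [hf, ← Summable.tsum_finsetSum fun y _ => hsum y, ← tsum_mul_left]
      refine tsum_congr fun n => ?_
      rw [walkCount, ← Finset.sum_div, pow_succ t (n + 1)]
      field_simp
    rw [h2, h1]
    refine mul_le_mul_of_nonneg_left ?_ ht0.le
    linarith [div_nonneg (T.walkCount_nonneg o 0 x) (pow_nonneg ht0.le 1)]
  have hadj : ∀ x y, T.Adj x y → 0 < f y → 0 < f x := by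
    intro x y hxy hy
    have h1 : f y ≤ ∑ z ∈ T.neighborFinset x, f z :=
      Finset.single_le_sum (fun z _ => hf0 z) ((T.mem_neighborFinset x y).2 hxy)
    have h2 := h1.trans (hle x)
    exact pos_of_mul_pos_right (hy.trans_le h2) ht0.le
  have ho : 0 < f o := by
    refine (hsum o).tsum_pos (fun n => div_nonneg (T.walkCount_nonneg o n o) (by positivity)) 0 ?_
    simp [walkCount, ht0]
  refine ⟨f, fun x => ?_, hle⟩
  have hwalk : ∀ x y (_ : T.Walk x y), 0 < f y → 0 < f x := by
    intro x y w
    induction w with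
    | nil => exact id
    | cons h _ ih => exact fun hy => hadj _ _ h (ih hy)
  obtain ⟨w⟩ := hT x o
  exact hwalk x o w ho

end SimpleGraph

/-! ### Walking in the universal covering tree -/

namespace MultiGraph

section Tree

variable {V E : Type*} (G : MultiGraph V E) {v₀ : V}

theorem tail_rev (d : G.Dart) : G.tail (G.rev d) = G.head d := by
  obtain ⟨e, _ | _⟩ := d <;> rfl

theorem head_rev (d : G.Dart) : G.head (G.rev d) = G.tail d := by
  obtain ⟨e, _ | _⟩ := d <;> rfl

theorem rev_rev (d : G.Dart) : G.rev (G.rev d) = d := by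
  obtain ⟨e, _ | _⟩ := d <;> rfl

/-- The vertex of `G` below a vertex of the universal covering tree. -/
def UnivCover.proj {G : MultiGraph V E} (w : G.UnivCover v₀) : V :=
  match w.1 with
  | [] => v₀
  | d :: _ => G.tail d

/-- The edge of the universal covering tree from `w` to `w'` lies above `d`. -/
def IsStep (w : G.UnivCover v₀) (d : G.Dart) (w' : G.UnivCover v₀) : Prop :=
  w'.1 = G.rev d :: w.1 ∨ w.1 = d :: w'.1

variable {G}

/-- Lifting of an edge to the tree: if the walk begins with `d`, that dart is removed; otherwise
`G.rev d` is put in front, and the walk stays non-backtracking. -/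
theorem exists_isStep (w : G.UnivCover v₀) (d : G.Dart) (hd : G.tail d = w.proj) :
    ∃ w' : G.UnivCover v₀, w'.proj = G.head d ∧ G.IsStep w d w' := by
  obtain ⟨l, hl, hl'⟩ := w
  rcases l with _ | ⟨a, l⟩
  · refine ⟨⟨[G.rev d], List.isChain_singleton _, ?_⟩, G.tail_rev d, Or.inl rfl⟩
    intro b hb
    obtain rfl : G.rev d = b := by simpa using hb
    rw [head_rev]
    exact hd
  · by_cases had : a = d
    · subst had
      have h2 : ∀ b ∈ l.getLast?, G.head b = v₀ := by
        intro b hb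
        refine hl' b ?_
        rcases l with _ | ⟨c, l⟩
        · simp at hb
        · rwa [List.getLast?_cons_cons]
      refine ⟨⟨l, hl.tail, h2⟩, ?_, Or.inr rfl⟩
      rcases l with _ | ⟨c, l⟩
      · exact (hl' a (by simp)).symm
      · exact (List.isChain_cons_cons.1 hl).1.1.symm
    · refine ⟨⟨G.rev d :: a :: l, List.isChain_cons_cons.2 ⟨⟨?_, ?_⟩, hl⟩, ?_⟩, G.tail_rev d,
        Or.inl rfl⟩
      · rw [head_rev]
        exact hd
      · rwa [rev_rev]
      · intro b hb
        exact hl' b (by rwa [List.getLast?_cons_cons] at hb)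

theorem IsStep.adj {w w' : G.UnivCover v₀} {d : G.Dart} (h : G.IsStep w d w') :
    (G.univCoverTree v₀).Adj w w' := by
  rcases h with h | h
  · exact Or.inl ⟨_, h⟩
  · exact Or.inr ⟨_, h⟩

theorem IsStep.symm {w w' : G.UnivCover v₀} {d : G.Dart} (h : G.IsStep w d w') :
    G.IsStep w' (G.rev d) w := by
  rcases h with h | h
  · exact Or.inr h
  · exact Or.inl (by rw [rev_rev]; exact h)

theorem IsStep.dart_eq {w w' : G.UnivCover v₀} {d d' : G.Dart} (h : G.IsStep w d w')
    (h' : G.IsStep w d' w') : d = d' := by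
  rcases h with h | h <;> rcases h' with h' | h'
  · have := (List.cons.inj (h.symm.trans h')).1
    rw [← G.rev_rev d, this, rev_rev]
  · rw [h] at h'
    exact absurd (congrArg List.length h') (by simp; omega)
  · rw [h'] at h
    exact absurd (congrArg List.length h) (by simp; omega)
  · exact (List.cons.inj (h.symm.trans h')).1

/-- Adding `G.rev d` in front of `w` and removing `d` from its front exclude each other, since
otherwise the longer walk would backtrack. -/
theorem IsStep.target_eq {w w₁ w₂ : G.UnivCover v₀} {d : G.Dart} (h₁ : G.IsStep w d w₁)
    (h₂ : G.IsStep w d w₂) : w₁ = w₂ := by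
  have key : ∀ a b : G.UnivCover v₀, a.1 = G.rev d :: w.1 → w.1 = d :: b.1 → False := by
    intro a b ha hb
    have := a.2.1
    rw [ha, hb] at this
    exact (List.isChain_cons_cons.1 this).1.2 (G.rev_rev d).symm
  rcases h₁ with h₁ | h₁ <;> rcases h₂ with h₂ | h₂
  · exact Subtype.ext (h₁.trans h₂.symm)
  · exact (key _ _ h₁ h₂).elim
  · exact (key _ _ h₂ h₁).elim
  · exact Subtype.ext (List.cons.inj (h₁.symm.trans h₂)).2

theorem univCoverTree_preconnected (v₀ : V) : (G.univCoverTree v₀).Preconnected := by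
  have key : ∀ (n : ℕ) (w : G.UnivCover v₀), w.1.length = n →
      (G.univCoverTree v₀).Reachable w ⟨[], List.isChain_nil, by simp⟩ := by
    intro n
    induction n with
    | zero =>
      intro w hw
      have : w = ⟨[], List.isChain_nil, by simp⟩ := Subtype.ext (List.length_eq_zero_iff.1 hw)
      exact this ▸ SimpleGraph.Reachable.refl _
    | succ n ih =>
      intro w hw
      obtain ⟨d, l, hl⟩ := List.exists_cons_of_length_eq_add_one hw
      obtain ⟨w', -, hw'⟩ := exists_isStep w d (by simp [UnivCover.proj, hl])
      have hlen : w'.1.length = n := by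
        rcases hw' with h | h
        · have := w'.2.1
          rw [h, hl] at this
          exact ((List.isChain_cons_cons.1 this).1.2 (G.rev_rev d).symm).elim
        · rw [h] at hw
          simpa using hw
      exact hw'.adj.reachable.trans (ih w' hlen)
  exact fun w w' => (key _ w rfl).trans (key _ w' rfl).symm

theorem exists_proj_eq (hG : G.Connected) (v₀ v : V) : ∃ w : G.UnivCover v₀, w.proj = v := by
  have key : ∀ x y (_ : G.toSimple.Walk x y), (∃ w : G.UnivCover v₀, w.proj = y) →
      ∃ w : G.UnivCover v₀, w.proj = x := by
    intro x y p
    induction p with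
    | nil => exact id
    | cons h _ ih =>
      intro hy
      obtain ⟨w, rfl⟩ := ih hy
      obtain ⟨-, ⟨e, h1, h2⟩ | ⟨e, h1, h2⟩⟩ := h
      · obtain ⟨w', hw', -⟩ := exists_isStep w (e, false) h2
        exact ⟨w', hw'.trans h1⟩
      · obtain ⟨w', hw', -⟩ := exists_isStep w (e, true) h1
        exact ⟨w', hw'.trans h2⟩
  obtain ⟨p⟩ := hG.preconnected v v₀
  exact key _ _ p ⟨⟨[], List.isChain_nil, by simp⟩, rfl⟩

end Tree

/-! ### Positivity of the signed averages above the spectral radius -/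

section Positivity

variable {V E W F : Type*} {G : MultiGraph V E} {H : MultiGraph W F} {v₀ : V}
  [Fintype E] [Fintype W] [DecidableEq W] [Fintype F] [DecidableEq F]

-- Darts at `x` have distinct images in `G`, hence lift to edges of the tree from `w` to distinct
-- neighbours.
omit [Fintype W] [DecidableEq W] [Fintype F] [DecidableEq F] in
theorem sum_step_le (p : Hom H G)
    (hp : ∀ w : W, Set.InjOn p.onDart {δ | H.tail δ = w}) {f : G.UnivCover v₀ → ℝ}
    (hf : ∀ w, 0 < f w) (x : W) (w : G.UnivCover v₀) (D : Finset H.Dart)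
    (hD : ∀ δ ∈ D, H.tail δ = x) (g : H.Dart → G.UnivCover v₀)
    (hg : ∀ δ ∈ D, G.IsStep w (p.onDart δ) (g δ)) :
    ∑ δ ∈ D, f (g δ) ≤ ∑ w' ∈ (G.univCoverTree v₀).neighborFinset w, f w' := by
  classical
  have hinj : Set.InjOn g D := by
    intro δ hδ δ' hδ' h
    have h1 := hg δ hδ
    rw [h] at h1
    exact hp x (hD δ hδ) (hD δ' hδ') (h1.dart_eq (hg δ' hδ'))
  rw [← Finset.sum_image hinj]
  refine Finset.sum_le_sum_of_subset_of_nonneg ?_ fun w' _ _ => (hf w').le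
  intro w' hw'
  obtain ⟨δ, hδ, rfl⟩ := Finset.mem_image.1 hw'
  exact (SimpleGraph.mem_neighborFinset _ _ _).2 (hg δ hδ).adj

omit [Fintype E] [Fintype W] [DecidableEq W] [Fintype F] [DecidableEq F] in
theorem Hom.head_onDart (p : Hom H G) (δ : H.Dart) :
    G.head (p.onDart δ) = p.onVert (H.head δ) := by
  rw [← tail_rev, ← p.onDart_rev, p.tail_onDart, tail_rev]

/-- Positivity is proved together with the bound `f w / f w'` for the ratio of `signSum` on `K.erase
x` to `signSum` on `K`, where `x` lies in `K` below `w` and the step to `w'` leaves `K`. In the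
recursion at `x` this bound, for the smaller set and the reversed darts, replaces each ratio by `f
(g' δ) / f w`. The supersolution inequality then leaves room for the neighbours of `w` above
vertices outside `K`, which is what the next stage of the induction uses. -/
theorem signSum_pos_of_supersolution (hG : G.Connected) (hH : ∀ f, H.src f ≠ H.tgt f)
    (p : Hom H G) (hp : ∀ w : W, Set.InjOn p.onDart {δ | H.tail δ = w})
    {f : G.UnivCover v₀ → ℝ} (hf : ∀ w, 0 < f w) {t' t : ℝ} (ht : t' < t)
    (hle : ∀ w, ∑ w' ∈ (G.univCoverTree v₀).neighborFinset w, f w' ≤ t' * f w)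
    (K : Finset W) : 0 < H.signSum t K ∧
      ∀ (δ : H.Dart) (w w' : G.UnivCover v₀), H.tail δ ∈ K → H.head δ ∉ K →
        w.proj = p.onVert (H.tail δ) → G.IsStep w (p.onDart δ) w' →
        H.signSum t (K.erase (H.tail δ)) * f w' ≤ H.signSum t K * f w := by
  classical
  induction K using Finset.strongInduction with
  | H K ih =>
    have main : ∀ x ∈ K, ∀ w : G.UnivCover v₀, w.proj = p.onVert x → ∀ D : Finset H.Dart,
        ∀ g : H.Dart → G.UnivCover v₀,
        (∀ δ ∈ D, H.tail δ = x ∧ H.head δ ∉ K ∧ G.IsStep w (p.onDart δ) (g δ)) →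
        H.signSum t (K.erase x) * ((t - t') * f w + ∑ δ ∈ D, f (g δ)) ≤ H.signSum t K * f w := by
      intro x hx w hw D g hD
      have ihx := ih _ (Finset.erase_ssubset hx)
      set D' := Finset.univ.filter fun δ : H.Dart => H.tail δ = x ∧ H.head δ ∈ K.erase x with hD'
      have hex : ∀ δ : H.Dart, ∃ w' : G.UnivCover v₀, H.tail δ = x →
          w'.proj = G.head (p.onDart δ) ∧ G.IsStep w (p.onDart δ) w' := by
        intro δ
        by_cases h : H.tail δ = x
        · obtain ⟨w', h'⟩ := exists_isStep w (p.onDart δ) (by rw [p.tail_onDart, h, hw])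
          exact ⟨w', fun _ => h'⟩
        · exact ⟨w, fun h' => (h h').elim⟩
      choose g' hg' using hex
      -- The induction hypothesis for `K.erase x`, applied to the reversed dart, whose head `x` has
      -- just been removed.
      have hterm : ∀ δ ∈ D', H.signSum t ((K.erase x).erase (H.head δ)) * f w ≤
          H.signSum t (K.erase x) * f (g' δ) := by
        intro δ hδ
        obtain ⟨h1, h2⟩ := (Finset.mem_filter.1 hδ).2
        have := ihx.2 (H.rev δ) (g' δ) w (by rwa [tail_rev])
          (by rw [head_rev, h1]; exact Finset.notMem_erase x K)
          (by rw [(hg' δ h1).1, tail_rev, p.head_onDart])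
          (by rw [p.onDart_rev]; exact (hg' δ h1).2.symm)
        rwa [tail_rev] at this
      -- The darts of `D'` stay in `K` and those of `D` leave it, so together they lift to distinct
      -- neighbours of `w`.
      have hsum : ∑ δ ∈ D', f (g' δ) + ∑ δ ∈ D, f (g δ) ≤ t' * f w := by
        have hdisj : Disjoint D' D := by
          rw [Finset.disjoint_left]
          intro δ h1 h2
          exact (hD δ h2).2.1 (Finset.mem_of_mem_erase (Finset.mem_filter.1 h1).2.2)
        have e : ∑ δ ∈ D, f (g δ) = ∑ δ ∈ D, f (g' δ) := by
          refine Finset.sum_congr rfl fun δ hδ => ?_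
          rw [(hD δ hδ).2.2.target_eq (hg' δ (hD δ hδ).1).2]
        rw [e, ← Finset.sum_union hdisj]
        refine (sum_step_le p hp hf x w _ ?_ g' ?_).trans (hle w)
        · intro δ hδ
          rcases Finset.mem_union.1 hδ with h | h
          · exact (Finset.mem_filter.1 h).2.1
          · exact (hD δ h).1
        · intro δ hδ
          rcases Finset.mem_union.1 hδ with h | h
          · exact (hg' δ (Finset.mem_filter.1 h).2.1).2
          · exact (hg' δ (hD δ h).1).2
      have h3 := Finset.sum_le_sum hterm
      rw [← Finset.sum_mul, ← Finset.mul_sum] at h3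
      rw [signSum_eq hH t hx]
      nlinarith [mul_le_mul_of_nonneg_left hsum ihx.1.le]
    refine ⟨?_, ?_⟩
    · rcases K.eq_empty_or_nonempty with rfl | ⟨x, hx⟩
      · exact signSum_empty_pos t
      · obtain ⟨w, hw⟩ := exists_proj_eq hG v₀ (p.onVert x)
        have h := main x hx w hw ∅ (fun _ => w) (by simp)
        have h1 := (ih _ (Finset.erase_ssubset hx)).1
        rw [Finset.sum_empty, add_zero] at h
        have h2 : 0 < (t - t') * f w := mul_pos (sub_pos.2 ht) (hf w)
        exact pos_of_mul_pos_left ((mul_pos h1 h2).trans_le h) (hf w).le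
    · intro δ w w' h1 h2 hw hstep
      have h := main _ h1 w hw {δ} (fun _ => w') (by
        intro δ' hδ'
        obtain rfl := Finset.mem_singleton.1 hδ'
        exact ⟨rfl, h2, hstep⟩)
      rw [Finset.sum_singleton, mul_add] at h
      have h3 := (ih _ (Finset.erase_ssubset h1)).1
      have h4 : 0 < (t - t') * f w := mul_pos (sub_pos.2 ht) (hf w)
      linarith [mul_pos h3 h4]

theorem sum_det_signAdj_pos (hG : G.Connected) (hH : ∀ f, H.src f ≠ H.tgt f)
    (p : Hom H G) (hp : ∀ w : W, Set.InjOn p.onDart {δ | H.tail δ = w}) {t : ℝ}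
    (ht : G.rho v₀ < t) : 0 < ∑ s : F → ℤˣ, (t • 1 - H.signAdj s).det := by
  obtain ⟨t', h1, h2⟩ := exists_between ht
  obtain ⟨f, hf, hle⟩ := (G.univCoverTree v₀).exists_pos_sum_neighborFinset_le
    (univCoverTree_preconnected v₀) ⟨[], List.isChain_nil, by simp⟩ _
    (G.univCoverTree_degree_le v₀) h1
  rw [← signSum_univ]
  exact (signSum_pos_of_supersolution hG hH p hp hf h2 hle Finset.univ).1

/-- Above `ρ(G)`, the sum over all `(d + 1)`-sheeted permutation coverings of the characteristic
polynomials of their new parts is positive. -/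
theorem sum_det_stdPerm_pos [Fintype V] [DecidableEq V] [DecidableEq E] (hG : G.Connected)
    (hloop : ∀ e, G.src e ≠ G.tgt e) (d : ℕ) {t : ℝ} (ht : G.rho v₀ < t) :
    0 < ∑ σ : E → Equiv.Perm (Fin (d + 1)),
      (t • 1 - G.twistAdj fun e => (Matrix.stdPerm (σ e), Matrix.stdPerm (σ e)⁻¹)).det := by
  have h := G.sum_det_stdPerm_eq_sum_det_signAdj d t
  have h1 : 0 < ∑ σ : E → Equiv.Perm (Fin d), ∑ s : E × Fin d → ℤˣ,
      (t • 1 - (G.permCover σ).signAdj s).det :=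
    Finset.sum_pos (fun σ _ => sum_det_signAdj_pos hG (fun f hf => hloop f.1 (congrArg Prod.fst hf))
      (G.permCoverHom σ) (fun w => (G.permCoverHom_bijOn σ w).injOn) ht) Finset.univ_nonempty
  have h2 : (0 : ℝ) < (Fintype.card (Equiv.Perm (Fin (d + 1))) : ℝ) ^ Fintype.card E := by
    have := Fintype.card_pos (α := Equiv.Perm (Fin (d + 1)))
    positivity
  exact pos_of_mul_pos_right ((mul_pos h2 h1).trans_eq h.symm) (by positivity)

end Positivity

end MultiGraph

/-! ### Real polynomials whose quotients preserve the upper half-plane -/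

namespace Polynomial

theorem aeval_complex_eq_pow_mul (p : ℝ[X]) {N : ℕ} (hp : p.natDegree ≤ N) {z : ℂ} (hz : z ≠ 0) :
    aeval z p = aeval z⁻¹ (p.reflect N) * z ^ N := by
  let := invertibleOfNonzero hz
  have := eval₂_reflect_mul_pow (algebraMap ℝ ℂ) z N p hp
  rw [invOf_eq_inv] at this
  simp only [aeval_def]
  exact this.symm

/-- At infinity `q / p` behaves like `q.coeff N / z`. Passing to `z⁻¹` and the reflected polynomials
turns this into continuity at `0`. -/
theorem tendsto_mul_aeval_div_vertical (p q : ℝ[X]) {N : ℕ} (hp : p.Monic)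
    (hN : p.natDegree = N + 1) (hq : q.natDegree ≤ N) (x : ℝ) :
    Filter.Tendsto (fun y : ℝ => (y : ℂ) * (aeval (x + y * Complex.I : ℂ) q /
      aeval (x + y * Complex.I : ℂ) p)) Filter.atTop (nhds (-Complex.I * q.coeff N)) := by
  have h1 : Filter.Tendsto (fun y : ℝ => ((y : ℂ))⁻¹) Filter.atTop (nhds 0) := by
    have := (Complex.continuous_ofReal.tendsto 0).comp tendsto_inv_atTop_zero
    simpa [Function.comp_def] using this
  have h2 : Filter.Tendsto (fun y : ℝ => ((x : ℂ) * (y : ℂ)⁻¹ + Complex.I)⁻¹) Filter.atTop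
      (nhds (-Complex.I)) := by
    have := ((h1.const_mul (x : ℂ)).add_const Complex.I).inv₀ (by simp)
    simpa using this
  have h3 : Filter.Tendsto (fun y : ℝ => (x + y * Complex.I : ℂ)⁻¹) Filter.atTop (nhds 0) := by
    have := h1.mul h2
    rw [zero_mul] at this
    refine this.congr' ?_
    filter_upwards [Filter.eventually_gt_atTop 0] with y hy
    have hy' : (y : ℂ) ≠ 0 := by exact_mod_cast hy.ne'
    rw [← mul_inv]
    congr 1
    field_simp
  have h4 : ∀ r : ℝ[X], Filter.Tendsto (fun y : ℝ => aeval (x + y * Complex.I : ℂ)⁻¹ r)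
      Filter.atTop (nhds (r.coeff 0 : ℂ)) := by
    intro r
    have := (r.continuous_aeval (A := ℂ)).tendsto 0 |>.comp h3
    simpa [Function.comp_def, aeval_def, eval₂_at_zero] using this
  have hP0 : (p.reflect (N + 1)).coeff 0 = 1 := by
    rw [coeff_reflect, revAt_le (Nat.zero_le _), Nat.sub_zero, ← hN]
    exact hp
  have hQ0 : (q.reflect N).coeff 0 = q.coeff N := by
    rw [coeff_reflect, revAt_le (Nat.zero_le _), Nat.sub_zero]
  have h5 := h2.mul ((h4 (q.reflect N)).div (h4 (p.reflect (N + 1))) (by rw [hP0]; simp))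
  rw [hP0, hQ0, Complex.ofReal_one, div_one] at h5
  simp only [Pi.div_apply] at h5
  refine h5.congr' ?_
  filter_upwards [Filter.eventually_gt_atTop 0] with y hy
  have hy' : (y : ℂ) ≠ 0 := by exact_mod_cast hy.ne'
  have hz : (x + y * Complex.I : ℂ) ≠ 0 := by
    intro h
    have := congrArg Complex.im h
    simp at this
    exact hy.ne' this
  rw [aeval_complex_eq_pow_mul q hq hz, aeval_complex_eq_pow_mul p hN.le hz, pow_succ]
  have e : ((x : ℂ) * (y : ℂ)⁻¹ + Complex.I)⁻¹ = y * (x + y * Complex.I : ℂ)⁻¹ := by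
    rw [← inv_inv (y : ℂ), ← mul_inv]
    congr 1
    field_simp
  rw [e]
  generalize aeval (x + y * Complex.I : ℂ)⁻¹ (q.reflect N) = a
  generalize aeval (x + y * Complex.I : ℂ)⁻¹ (p.reflect (N + 1)) = b
  generalize (x + y * Complex.I : ℂ) = z at hz
  rcases eq_or_ne b 0 with rfl | hb
  · simp
  · field_simp

/-- If all the polynomials `p + s q` (`s` real) have no zeros in the upper half-plane, then `q / p`
maps it to the lower half-plane, unless it vanishes. -/
theorem im_aeval_div_le (p q : ℝ[X]) {N : ℕ} (hp : p.Monic) (hN : p.natDegree = N + 1)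
    (hq : q.natDegree ≤ N) (hq0 : 0 < q.coeff N)
    (h : ∀ (s : ℝ) (z : ℂ), 0 < z.im → aeval z (p + C s * q) ≠ 0) {z : ℂ} (hz : 0 < z.im) :
    (aeval z q / aeval z p).im ≤ 0 ∧ ((aeval z q / aeval z p).im = 0 → aeval z q = 0) := by
  have hp0 : ∀ z : ℂ, 0 < z.im → aeval z p ≠ 0 := fun z hz => by
    simpa using h 0 z hz
  -- A nonzero real value `c` of `q / p` at `z` would make `z` a zero of `p - c⁻¹ q`.
  have hreal : ∀ z : ℂ, 0 < z.im → (aeval z q / aeval z p).im = 0 → aeval z q = 0 := by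
    intro z hz him
    by_contra hne
    set c := (aeval z q / aeval z p).re with hc
    have e : aeval z q / aeval z p = (c : ℂ) := Complex.ext (by simp [hc]) (by simp [him])
    have hc0 : (c : ℂ) ≠ 0 := by
      rw [← e]
      exact div_ne_zero hne (hp0 z hz)
    refine h (-c⁻¹) z hz ?_
    have e2 : aeval z q = c * aeval z p := by
      rw [← e, div_mul_cancel₀ _ (hp0 z hz)]
    simp only [map_add, map_mul, aeval_C, e2]
    simp [hc0]
  refine ⟨?_, hreal z hz⟩
  by_contra! hpos
  have hq_ne : q ≠ 0 := by
    rintro rfl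
    simp at hq0
  set φ : ℂ → ℂ := fun z => aeval z q / aeval z p with hφ
  have hcont : ∀ z : ℂ, 0 < z.im → ContinuousAt φ z := fun z hz =>
    (q.continuous_aeval.continuousAt).div (p.continuous_aeval.continuousAt) (hp0 z hz)
  -- If the imaginary part were positive at `z`, it would still be so on a nearby vertical line that
  -- avoids the zeros of `q`. High up on that line it is negative, so it vanishes in between, and
  -- `hreal` forces a zero of `q` there.
  set B : Set ℝ := Complex.re '' (q.aroots ℂ).toFinset with hB
  have hBfin : B.Finite := (Finset.finite_toSet _).image _
  obtain ⟨x, hxB, hx⟩ : ∃ x : ℝ, x ∉ B ∧ 0 < (φ (x + z.im * Complex.I)).im := by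
    have hline : ContinuousAt (fun x : ℝ => (φ (x + z.im * Complex.I)).im) z.re := by
      refine Complex.continuous_im.continuousAt.comp ?_
      refine ContinuousAt.comp (f := fun x : ℝ => (x + z.im * Complex.I : ℂ)) (g := φ)
        (hcont _ (by simpa using hz)) ?_
      fun_prop
    have h1 : ∀ᶠ x : ℝ in nhds z.re, 0 < (φ (x + z.im * Complex.I)).im :=
      hline.eventually (lt_mem_nhds (by simpa only [Complex.re_add_im] using hpos))
    have h2 := (hBfin.countable.dense_compl ℝ).inter_nhds_nonempty h1
    obtain ⟨x, hx1, hx2⟩ := h2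
    exact ⟨x, hx1, hx2⟩
  have hlim := (Complex.continuous_im.tendsto _).comp (tendsto_mul_aeval_div_vertical p q hp hN hq x)
  have hneg : ∀ᶠ y : ℝ in Filter.atTop, (φ (x + y * Complex.I)).im < 0 := by
    have hl : (-Complex.I * (q.coeff N : ℂ)).im < 0 := by simpa using hq0
    filter_upwards [hlim.eventually (gt_mem_nhds hl), Filter.eventually_gt_atTop 0] with y hy hy0
    have : y * (φ (x + y * Complex.I)).im < 0 := by
      simpa [Function.comp_def, hφ] using hy
    by_contra! hcon
    exact absurd this (not_lt.2 (mul_nonneg hy0.le hcon))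
  obtain ⟨y₁, hy₁, hy₁'⟩ := (hneg.and (Filter.eventually_ge_atTop z.im)).exists
  have hIVT := intermediate_value_Icc' (f := fun y : ℝ => (φ (x + y * Complex.I)).im) hy₁' (by
    intro y hy
    refine ContinuousAt.continuousWithinAt ?_
    refine Complex.continuous_im.continuousAt.comp ?_
    refine ContinuousAt.comp (f := fun y : ℝ => (x + y * Complex.I : ℂ)) (g := φ)
      (hcont _ (by simpa using hz.trans_le hy.1)) ?_
    fun_prop)
  obtain ⟨y, hy, hy0⟩ := hIVT ⟨hy₁.le, hx.le⟩
  have := hreal (x + y * Complex.I) (by simpa using hz.trans_le hy.1) hy0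
  refine hxB ⟨x + y * Complex.I, ?_, by simp⟩
  simp only [Finset.mem_coe, Multiset.mem_toFinset]
  exact (mem_aroots.2 ⟨hq_ne, this⟩)

theorem aeval_ofReal_complex (p : ℝ[X]) (x : ℝ) : aeval (x : ℂ) p = ((p.eval x : ℝ) : ℂ) := by
  rw [← Complex.coe_algebraMap, aeval_algebraMap_apply_eq_algebraMap_eval]

/-- The Wronskian of two real polynomials whose quotient preserves the upper half-plane. -/
theorem wronskian_nonneg_of_im_nonneg (p g : ℝ[X])
    (h : ∀ z : ℂ, 0 < z.im → 0 ≤ (aeval z p / aeval z g).im) (x : ℝ) :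
    0 ≤ (derivative p).eval x * g.eval x - p.eval x * (derivative g).eval x := by
  set l : ℝ → ℂ := fun y => x + y * Complex.I with hl
  have hld : HasDerivAt l Complex.I 0 := by
    have := ((Complex.ofRealCLM.hasDerivAt (x := (0 : ℝ))).mul_const Complex.I).const_add (x : ℂ)
    simpa [hl] using this
  have hl0 : l 0 = (x : ℂ) := by simp [hl]
  have hpoly : ∀ r : ℝ[X], HasDerivAt (fun y => aeval (l y) r)
      ((((derivative r).eval x : ℝ) : ℂ) * Complex.I) 0 := by
    intro r
    have h1 := (r.hasDerivAt_aeval (l 0)).comp (0 : ℝ) hld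
    rw [hl0, aeval_ofReal_complex] at h1
    exact h1
  -- `Im (p / g)` has the sign of `Im (p * conj g)` where `g` does not vanish. The latter is zero on
  -- the real axis, and its vertical derivative there is the Wronskian.
  have hd : HasDerivAt (fun y => (aeval (l y) p * (starRingEnd ℂ) (aeval (l y) g)).im)
      ((derivative p).eval x * g.eval x - p.eval x * (derivative g).eval x) 0 := by
    have h2 := (hpoly p).mul (Complex.conjCLE.hasFDerivAt.comp_hasDerivAt (0 : ℝ) (hpoly g))
    have h3 := Complex.imCLM.hasFDerivAt.comp_hasDerivAt (0 : ℝ) h2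
    refine HasDerivAt.congr_deriv h3 ?_
    simp [hl0, aeval_ofReal_complex]
    ring
  have hslope := hd.tendsto_slope_zero_right
  refine ge_of_tendsto hslope ?_
  filter_upwards [self_mem_nhdsWithin] with y hy
  have hy : 0 < y := hy
  have h0 : (aeval (l 0) p * (starRingEnd ℂ) (aeval (l 0) g)).im = 0 := by
    rw [hl0, aeval_ofReal_complex, aeval_ofReal_complex, Complex.conj_ofReal, ← Complex.ofReal_mul,
      Complex.ofReal_im]
  rw [zero_add, h0, sub_zero]
  refine mul_nonneg (inv_nonneg.2 hy.le) ?_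
  have h4 := h (l y) (by simpa [hl] using hy)
  rcases eq_or_ne (aeval (l y) g) 0 with hg | hg
  · simp [hg]
  · rw [div_eq_mul_inv, Complex.inv_def, ← mul_assoc, Complex.im_mul_ofReal] at h4
    exact nonneg_of_mul_nonneg_left h4 (inv_pos.2 (Complex.normSq_pos.2 hg))

theorem monotoneOn_div_of_im_nonneg (p g : ℝ[X])
    (h : ∀ z : ℂ, 0 < z.im → 0 ≤ (aeval z p / aeval z g).im) {S : Set ℝ} (hS : Convex ℝ S)
    (hg : ∀ x ∈ S, 0 < g.eval x) : MonotoneOn (fun x => p.eval x / g.eval x) S := by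
  have hder : ∀ x ∈ S, HasDerivAt (fun x => p.eval x / g.eval x)
      (((derivative p).eval x * g.eval x - p.eval x * (derivative g).eval x) / g.eval x ^ 2) x :=
    fun x hx => (p.hasDerivAt x).div (g.hasDerivAt x) (hg x hx).ne'
  refine monotoneOn_of_deriv_nonneg hS (fun x hx => (hder x hx).continuousAt.continuousWithinAt)
    (fun x hx => (hder x (interior_subset hx)).differentiableAt.differentiableWithinAt)
    fun x hx => ?_
  rw [(hder x (interior_subset hx)).deriv]
  exact div_nonneg (wronskian_nonneg_of_im_nonneg p g h x) (sq_nonneg _)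

theorem Monic.pos_of_no_root {g : ℝ[X]} (hg : g.Monic) {α : ℝ} (h : ∀ x, α < x → g.eval x ≠ 0)
    {x : ℝ} (hx : α < x) : 0 < g.eval x := by
  by_contra! hle
  have hev : ∀ᶠ y in Filter.atTop, 0 < g.eval y := by
    rcases Nat.eq_zero_or_pos g.natDegree with h0 | h0
    · rw [hg.natDegree_eq_zero.1 h0]
      simp
    · exact (g.tendsto_atTop_of_leadingCoeff_nonneg (natDegree_pos_iff_degree_pos.1 h0)
        (by rw [hg]; exact zero_le_one)).eventually_gt_atTop 0
  obtain ⟨y, hy, hxy⟩ := (hev.and (Filter.eventually_ge_atTop x)).exists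
  obtain ⟨c, hc, hc0⟩ := intermediate_value_Icc hxy g.continuous.continuousOn ⟨hle, hy.le⟩
  exact h c (hx.trans_le hc.1) hc0

/-- `g` acts as a common interlacer: each `p / g` increases on intervals where `g > 0`. If both
conclusions fail, a single point above `ρ` is found at which `p₀` and `p₁` are both nonpositive,
against the hypothesis on their combination. -/
theorem forall_pos_or_forall_pos (p₀ p₁ g : ℝ[X]) (hg : g.Monic)
    (h₀ : ∀ z : ℂ, 0 < z.im → 0 ≤ (aeval z p₀ / aeval z g).im)
    (h₁ : ∀ z : ℂ, 0 < z.im → 0 ≤ (aeval z p₁ / aeval z g).im) {a b ρ : ℝ} (ha : 0 ≤ a)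
    (hb : 0 ≤ b) (h : ∀ t, ρ < t → 0 < a * p₀.eval t + b * p₁.eval t) :
    (∀ t, ρ < t → 0 < p₀.eval t) ∨ ∀ t, ρ < t → 0 < p₁.eval t := by
  by_contra! hcon
  obtain ⟨⟨t₀, ht₀, hp₀⟩, t₁, ht₁, hp₁⟩ := hcon
  have hfinish : ∀ t, ρ < t → p₀.eval t ≤ 0 → p₁.eval t ≤ 0 → False := fun t ht e₀ e₁ => by
    have := h t ht
    nlinarith [mul_nonneg ha (neg_nonneg.2 e₀), mul_nonneg hb (neg_nonneg.2 e₁)]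
  by_cases hroot : ∃ x, ρ < x ∧ g.eval x = 0
  · obtain ⟨α, hα, hmax⟩ : ∃ α, (ρ < α ∧ g.eval α = 0) ∧ ∀ x, α < x → g.eval x ≠ 0 := by
      set S := g.roots.toFinset.filter fun x => ρ < x with hS
      have hmem : ∀ x, x ∈ S ↔ ρ < x ∧ g.eval x = 0 := by
        intro x
        rw [hS, Finset.mem_filter, Multiset.mem_toFinset, mem_roots hg.ne_zero, and_comm, IsRoot]
      have hSne : S.Nonempty := hroot.imp fun x hx => (hmem x).2 hx
      have hmx := (hmem _).1 (S.max'_mem hSne)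
      refine ⟨S.max' hSne, hmx, fun x hx h0 => ?_⟩
      exact absurd (S.le_max' x ((hmem x).2 ⟨hmx.1.trans hx, h0⟩)) (not_le.2 hx)
    have hpos : ∀ x ∈ Set.Ioi α, 0 < g.eval x := fun x hx => hg.pos_of_no_root hmax hx
    -- To the right of the largest root `α` of `g` the increasing quotient gives `p ≤ C g` near `α`,
    -- so `p` is at most `0` at `α` in the limit.
    have key : ∀ p : ℝ[X], (∀ z : ℂ, 0 < z.im → 0 ≤ (aeval z p / aeval z g).im) →
        p.eval α ≤ 0 := by
      intro p hp
      have hmono := monotoneOn_div_of_im_nonneg p g hp (convex_Ioi α) hpos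
      have hbound : ∀ x ∈ Set.Ioc α (α + 1),
          p.eval x ≤ (p.eval (α + 1) / g.eval (α + 1)) * g.eval x := by
        intro x hx
        have := hmono hx.1 (by simp : α + 1 ∈ Set.Ioi α) hx.2
        exact (div_le_iff₀ (hpos x hx.1)).1 this
      have hmemc : α ∈ closure (Set.Ioc α (α + 1)) := by
        rw [closure_Ioc (by linarith : α ≠ α + 1)]
        simp
      have hcl := closure_minimal (t := {x | p.eval x ≤ (p.eval (α + 1) / g.eval (α + 1)) * g.eval x})
        hbound (isClosed_le p.continuous (continuous_const.mul g.continuous)) hmemc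
      simpa [hα.2] using hcl
    exact hfinish α hα.1 (key p₀ h₀) (key p₁ h₁)
  · push Not at hroot
    have hpos : ∀ x ∈ Set.Ioi ρ, 0 < g.eval x := fun x hx => hg.pos_of_no_root hroot hx
    -- Without a root of `g` above `ρ`, nonpositive values of `p` propagate to the left, so the
    -- smaller of `t₀` and `t₁` serves for both.
    have key : ∀ p : ℝ[X], (∀ z : ℂ, 0 < z.im → 0 ≤ (aeval z p / aeval z g).im) →
        ∀ s t, ρ < s → s ≤ t → p.eval t ≤ 0 → p.eval s ≤ 0 := by
      intro p hp s t hs hst ht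
      have := monotoneOn_div_of_im_nonneg p g hp (convex_Ioi ρ) hpos hs (hs.trans_le hst : ρ < t) hst
      have h2 : p.eval t / g.eval t ≤ 0 := div_nonpos_of_nonpos_of_nonneg ht
        (hpos t (hs.trans_le hst)).le
      exact nonpos_of_mul_nonpos_left ((div_le_iff₀ (hpos s hs)).1 (this.trans h2) |>.trans_eq
        (zero_mul _) |> fun h => by simpa using h) one_pos
    refine hfinish (min t₀ t₁) (lt_min ht₀ ht₁) ?_ ?_
    · exact key p₀ h₀ _ _ (lt_min ht₀ ht₁) (min_le_left _ _) hp₀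
    · exact key p₁ h₁ _ _ (lt_min ht₀ ht₁) (min_le_right _ _) hp₁

end Polynomial

/-! ### Stable families of polynomials and random swaps -/

section Stable

open Polynomial Matrix

variable {E n : Type*} [Fintype n] [DecidableEq n] [DecidableEq E]

/-- A family of monic polynomials, indexed by tuples of matrices, that behaves on tuples of
symmetric matrices like `det (t + ∑ e, X e)`. -/
structure IsStableFamily (F : (E → Matrix n n ℝ) → ℝ[X]) : Prop where
  monic : ∀ X, (∀ e, (X e).IsSymm) → (F X).Monic
  natDegree_eq : ∀ X, (∀ e, (X e).IsSymm) → (F X).natDegree = Fintype.card n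
  ne_zero : ∀ X, (∀ e, (X e).IsSymm) → ∀ z : ℂ, 0 < z.im → aeval z (F X) ≠ 0
  add_smul : ∀ X, (∀ e, (X e).IsSymm) → ∀ (e : E) (a : n → ℝ) (s : ℝ),
    F (Function.update X e (X e + s • vecMulVec a a)) =
      F X + C s * (F (Function.update X e (X e + vecMulVec a a)) - F X)
  coeff_sub : ∀ X, (∀ e, (X e).IsSymm) → ∀ (e : E) (a : n → ℝ),
    (F (Function.update X e (X e + vecMulVec a a)) - F X).coeff (Fintype.card n - 1) = a ⬝ᵥ a

/-- The action of tuples of permutations on tuples of matrices, by simultaneous permutations of the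
rows and the columns. -/
def permAct (γ : E → Equiv.Perm n) (X : E → Matrix n n ℝ) : E → Matrix n n ℝ :=
  fun e => (X e).submatrix ⇑(γ e)⁻¹ ⇑(γ e)⁻¹

omit [Fintype n] [DecidableEq n] [DecidableEq E] in
theorem permAct_mul (γ δ : E → Equiv.Perm n) (X : E → Matrix n n ℝ) :
    permAct (γ * δ) X = permAct γ (permAct δ X) := by
  funext e
  ext i j
  simp [permAct]

omit [Fintype n] [DecidableEq n] [DecidableEq E] in
theorem permAct_one (X : E → Matrix n n ℝ) : permAct 1 X = X := rfl

omit [Fintype n] [DecidableEq n] [DecidableEq E] in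
theorem permAct_isSymm {X : E → Matrix n n ℝ} (hX : ∀ e, (X e).IsSymm) (γ : E → Equiv.Perm n)
    (e : E) : (permAct γ X e).IsSymm :=
  (hX e).submatrix _

omit [Fintype n] [DecidableEq n] in
theorem permAct_update (γ : E → Equiv.Perm n) (X : E → Matrix n n ℝ) (e : E) (a : n → ℝ) (s : ℝ) :
    permAct γ (Function.update X e (X e + s • vecMulVec a a)) =
      Function.update (permAct γ X) e
        (permAct γ X e + s • vecMulVec (a ∘ ⇑(γ e)⁻¹) (a ∘ ⇑(γ e)⁻¹)) := by
  funext e'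
  by_cases h : e' = e
  · subst h
    ext i j
    simp [permAct, vecMulVec_apply]
  · simp [permAct, h]

omit [Fintype n] [DecidableEq n] in
theorem update_add_vecMulVec_isSymm {X : E → Matrix n n ℝ} (hX : ∀ e, (X e).IsSymm) (e : E)
    (a : n → ℝ) (s : ℝ) (e' : E) :
    (Function.update X e (X e + s • vecMulVec a a) e').IsSymm := by
  by_cases h : e' = e
  · subst h
    rw [Function.update_self]
    refine (hX e').add (IsSymm.smul ?_ s)
    rw [IsSymm, transpose_vecMulVec]
  · rw [Function.update_of_ne h]
    exact hX e'

namespace IsStableFamily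

variable {F : (E → Matrix n n ℝ) → ℝ[X]} {X : E → Matrix n n ℝ}

omit [DecidableEq n] in
theorem comp_permAct (hF : IsStableFamily F) (γ : E → Equiv.Perm n) :
    IsStableFamily fun X => F (permAct γ X) where
  monic X hX := hF.monic _ (permAct_isSymm hX γ)
  natDegree_eq X hX := hF.natDegree_eq _ (permAct_isSymm hX γ)
  ne_zero X hX := hF.ne_zero _ (permAct_isSymm hX γ)
  add_smul X hX e a s := by
    have h1 := permAct_update γ X e a 1
    rw [one_smul, one_smul] at h1
    rw [permAct_update, h1]
    exact hF.add_smul _ (permAct_isSymm hX γ) e _ s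
  coeff_sub X hX e a := by
    have h1 := permAct_update γ X e a 1
    rw [one_smul, one_smul] at h1
    rw [h1, hF.coeff_sub _ (permAct_isSymm hX γ) e]
    simp only [dotProduct, Function.comp_apply]
    exact Equiv.sum_comp (γ e)⁻¹ fun i => a i * a i

omit [DecidableEq n] in
theorem convexComb {G : (E → Matrix n n ℝ) → ℝ[X]} (hF : IsStableFamily F) (hG : IsStableFamily G)
    {α β : ℝ} (hαβ : α + β = 1)
    (hne : ∀ X, (∀ e, (X e).IsSymm) → ∀ z : ℂ, 0 < z.im → aeval z (C α * F X + C β * G X) ≠ 0) :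
    IsStableFamily fun X => C α * F X + C β * G X := by
  have hle : ∀ X, (∀ e, (X e).IsSymm) → (C α * F X + C β * G X).natDegree ≤ Fintype.card n :=
    fun X hX => natDegree_add_le_of_degree_le
      ((natDegree_C_mul_le _ _).trans (hF.natDegree_eq X hX).le)
      ((natDegree_C_mul_le _ _).trans (hG.natDegree_eq X hX).le)
  have hcoeff : ∀ X, (∀ e, (X e).IsSymm) →
      (C α * F X + C β * G X).coeff (Fintype.card n) = 1 := fun X hX => by
    have h1 := hF.monic X hX
    have h2 := hG.monic X hX
    rw [Monic, leadingCoeff, hF.natDegree_eq X hX] at h1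
    rw [Monic, leadingCoeff, hG.natDegree_eq X hX] at h2
    rw [coeff_add, coeff_C_mul, coeff_C_mul, h1, h2, mul_one, mul_one, hαβ]
  refine ⟨fun X hX => monic_of_natDegree_le_of_coeff_eq_one _ (hle X hX) (hcoeff X hX),
    fun X hX => natDegree_eq_of_le_of_coeff_ne_zero (hle X hX)
      (by rw [hcoeff X hX]; exact one_ne_zero), hne, fun X hX e a s => ?_, fun X hX e a => ?_⟩
  · simp only [hF.add_smul X hX e a s, hG.add_smul X hX e a s]
    ring
  · have e1 := hF.coeff_sub X hX e a
    have e2 := hG.coeff_sub X hX e a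
    rw [Polynomial.coeff_sub] at e1 e2 ⊢
    simp only [coeff_add, coeff_C_mul]
    linear_combination α * e1 + β * e2 + (a ⬝ᵥ a) * hαβ

-- With `Y` the updated tuple, `F X / F Y = 1 - (F Y - F X) / F Y`, and `im_aeval_div_le` applies to
-- the last quotient. So a positive rank-one update yields an interlacer.
omit [DecidableEq n] in
theorem im_div_update (hF : IsStableFamily F) (hX : ∀ e, (X e).IsSymm) (e : E) (a : n → ℝ)
    {z : ℂ} (hz : 0 < z.im) :
    0 ≤ (aeval z (F X) / aeval z (F (Function.update X e (X e + vecMulVec a a)))).im ∧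
      ((aeval z (F X) / aeval z (F (Function.update X e (X e + vecMulVec a a)))).im = 0 →
        aeval z (F X) = aeval z (F (Function.update X e (X e + vecMulVec a a)))) := by
  rcases eq_or_ne a 0 with rfl | ha
  · have : Function.update X e (X e + vecMulVec 0 0) = X := by simp
    rw [this, div_self (hF.ne_zero X hX z hz)]
    simp
  · have hY : ∀ e', (Function.update X e (X e + vecMulVec a a) e').IsSymm := by
      have := update_add_vecMulVec_isSymm hX e a 1
      rwa [one_smul] at this
    set Y := Function.update X e (X e + vecMulVec a a) with hYdef
    have hn : 0 < Fintype.card n := by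
      obtain ⟨i, -⟩ := Function.ne_iff.1 ha
      exact Fintype.card_pos_iff.2 ⟨i⟩
    obtain ⟨N, hN⟩ : ∃ N, Fintype.card n = N + 1 := ⟨_, (Nat.succ_pred_eq_of_pos hn).symm⟩
    have hcoeff := hF.coeff_sub X hX e a
    rw [hN, Nat.add_sub_cancel] at hcoeff
    have hdeg : (F Y - F X).natDegree ≤ N := by
      rcases eq_or_ne (F Y - F X) 0 with h0 | h0
      · rw [h0, natDegree_zero]
        exact Nat.zero_le N
      · rw [← Nat.lt_succ_iff, Nat.succ_eq_add_one, ← hN, ← hF.natDegree_eq Y hY]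
        refine natDegree_lt_natDegree h0 (degree_sub_lt_left ?_ (hF.monic Y hY).ne_zero ?_)
        · rw [degree_eq_natDegree (hF.monic Y hY).ne_zero,
            degree_eq_natDegree (hF.monic X hX).ne_zero, hF.natDegree_eq Y hY,
            hF.natDegree_eq X hX]
        · rw [(hF.monic Y hY).leadingCoeff, (hF.monic X hX).leadingCoeff]
    have key := im_aeval_div_le (F Y) (F Y - F X) (hF.monic Y hY) ((hF.natDegree_eq Y hY).trans hN)
      hdeg (by rw [hcoeff]; simpa using dotProduct_star_self_pos_iff.2 ha) (fun s w hw => by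
        -- `F Y + s (F Y - F X)` is the value of the family at `X e + (1 + s) a aᵀ`, hence has no
        -- zeros in the upper half-plane.
        have := hF.add_smul X hX e a (1 + s)
        have h2 := hF.ne_zero _ (update_add_vecMulVec_isSymm hX e a (1 + s)) w hw
        rw [this] at h2
        convert h2 using 2
        rw [← hYdef, C_add, C_1]
        ring) hz
    have hYz := hF.ne_zero Y hY z hz
    have e1 : aeval z (F X) / aeval z (F Y) = 1 - aeval z (F Y - F X) / aeval z (F Y) := by
      rw [map_sub]
      field_simp
      ring
    rw [e1, Complex.sub_im, Complex.one_im, zero_sub]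
    refine ⟨neg_nonneg.2 key.1, fun h => ?_⟩
    have := key.2 (neg_eq_zero.1 h)
    rw [map_sub, sub_eq_zero] at this
    exact this.symm

end IsStableFamily

-- With `v = e_i - e_j` the transposition is `τ = 1 - v vᵀ`, so `A - τ A τ = v yᵀ + y vᵀ` with `y =
-- A v - (vᵀ A v / 2) v`. This equals `b bᵀ - a aᵀ` for `b = v + y/2` and `a = v - y/2`.
omit [Fintype n] in
theorem submatrix_swap_eq {A : Matrix n n ℝ} (hA : A.IsSymm) {i j : n} (hij : i ≠ j) :
    ∃ a b : n → ℝ, A.submatrix (Equiv.swap i j) (Equiv.swap i j) + vecMulVec b b =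
      A + vecMulVec a a := by
  set v : n → ℝ := fun k => if k = i then 1 else if k = j then -1 else 0 with hv
  set y : n → ℝ := fun k => (A k i - A k j) - ((A i i - 2 * A i j + A j j) / 2) * v k with hy
  have hs : ∀ k l, A k l = A l k := fun k l => (hA.apply l k)
  refine ⟨fun k => v k - y k / 2, fun k => v k + y k / 2, ?_⟩
  have key : ∀ k l, A (Equiv.swap i j k) (Equiv.swap i j l) + (v k * y l + y k * v l) = A k l := by
    intro k l
    have hji := hs j i
    have h1 := hs k i
    have h2 := hs k j
    have h3 := hs l i
    have h4 := hs l j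
    rcases eq_or_ne k i with rfl | hki
    · rcases eq_or_ne l k with rfl | hlk
      · simp [hv, hy]; ring
      · rcases eq_or_ne l j with rfl | hlj
        · simp [hv, hy, hlk]; linarith
        · simp [hv, hy, hlk, hlj, Equiv.swap_apply_of_ne_of_ne hlk hlj]; linarith
    · rcases eq_or_ne k j with rfl | hkj
      · rcases eq_or_ne l i with rfl | hli
        · simp [hv, hy, hki]; linarith
        · rcases eq_or_ne l k with rfl | hlj
          · simp [hv, hy, hki]; linarith
          · simp [hv, hy, hki, hli, hlj, Equiv.swap_apply_of_ne_of_ne hli hlj]; linarith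
      · rw [Equiv.swap_apply_of_ne_of_ne hki hkj]
        rcases eq_or_ne l i with rfl | hli
        · simp [hv, hy, hki, hkj]
        · rcases eq_or_ne l j with rfl | hlj
          · simp [hv, hy, hki, hkj, hli]
          · simp [hv, hki, hkj, hli, hlj, Equiv.swap_apply_of_ne_of_ne hli hlj]
  ext k l
  simp only [Matrix.add_apply, submatrix_apply, vecMulVec_apply]
  linear_combination key k l

omit [Fintype n] in
theorem exists_update_permAct_swap {X : E → Matrix n n ℝ} (hX : ∀ e, (X e).IsSymm) (e : E)
    (i j : n) : ∃ a b : n → ℝ, Function.update (permAct (Pi.mulSingle e (Equiv.swap i j)) X) e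
      (permAct (Pi.mulSingle e (Equiv.swap i j)) X e + vecMulVec b b) =
        Function.update X e (X e + vecMulVec a a) := by
  rcases eq_or_ne i j with rfl | hij
  · refine ⟨0, 0, ?_⟩
    rw [Equiv.swap_self]
    have : (Pi.mulSingle e (Equiv.refl n) : E → Equiv.Perm n) = 1 := Pi.mulSingle_one e
    rw [this, permAct_one]
  · obtain ⟨a, b, h⟩ := submatrix_swap_eq (hX e) hij
    refine ⟨a, b, ?_⟩
    funext e'
    by_cases he : e' = e
    · subst he
      simpa [permAct] using h
    · simp [permAct, he]

namespace IsStableFamily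

variable {F : (E → Matrix n n ℝ) → ℝ[X]} {X : E → Matrix n n ℝ}

/-- A common interlacer of `F X` and `F (τ X)`, for a swap `τ`. -/
theorem exists_interlacer (hF : IsStableFamily F) (hX : ∀ e, (X e).IsSymm) (e : E) (i j : n) :
    ∃ g : ℝ[X], g.Monic ∧ ∀ z : ℂ, 0 < z.im → aeval z g ≠ 0 ∧
      ∀ p, p = F X ∨ p = F (permAct (Pi.mulSingle e (Equiv.swap i j)) X) →
        0 ≤ (aeval z p / aeval z g).im ∧
          ((aeval z p / aeval z g).im = 0 → aeval z p = aeval z g) := by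
  obtain ⟨a, b, h⟩ := exists_update_permAct_swap hX e i j
  have hY := update_add_vecMulVec_isSymm hX e a 1
  rw [one_smul] at hY
  refine ⟨F (Function.update X e (X e + vecMulVec a a)), hF.monic _ hY, fun z hz =>
    ⟨hF.ne_zero _ hY z hz, ?_⟩⟩
  rintro p (rfl | rfl)
  · exact hF.im_div_update hX e a hz
  · rw [← h]
    exact hF.im_div_update (permAct_isSymm hX _) e b hz

/-- At a zero of the average in the upper half-plane both quotients by the interlacer `g`, having
nonnegative imaginary parts, would be real. Then both polynomials agree there with `g`, and so does
their average; but `g` has no zero there. -/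
theorem swap (hF : IsStableFamily F) (e : E) (i j : n) {α β : ℝ} (hα : 0 < α) (hβ : 0 < β)
    (hαβ : α + β = 1) : IsStableFamily fun X =>
      C α * F X + C β * F (permAct (Pi.mulSingle e (Equiv.swap i j)) X) := by
  refine hF.convexComb (hF.comp_permAct _) hαβ fun X hX z hz h0 => ?_
  obtain ⟨g, -, hg⟩ := hF.exists_interlacer hX e i j
  obtain ⟨hg0, hg1⟩ := hg z hz
  obtain ⟨h1, h1'⟩ := hg1 _ (Or.inl rfl)
  obtain ⟨h2, h2'⟩ := hg1 _ (Or.inr rfl)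
  simp only [map_add, map_mul, aeval_C, Complex.coe_algebraMap] at h0
  have h3 : (α : ℂ) * (aeval z (F X) / aeval z g) +
      β * (aeval z (F (permAct (Pi.mulSingle e (Equiv.swap i j)) X)) / aeval z g) = 0 := by
    rw [← mul_div_assoc, ← mul_div_assoc, ← add_div, h0, zero_div]
  have h4 := congrArg Complex.im h3
  simp only [Complex.add_im, Complex.im_ofReal_mul, Complex.zero_im] at h4
  have e1 := h1' (by nlinarith [mul_nonneg hα.le h1, mul_nonneg hβ.le h2])
  have e2 := h2' (by nlinarith [mul_nonneg hα.le h1, mul_nonneg hβ.le h2])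
  rw [e1, e2, ← add_mul, ← Complex.ofReal_add, hαβ, Complex.ofReal_one, one_mul] at h0
  exact hg0 h0

theorem pos_or_pos (hF : IsStableFamily F) (hX : ∀ e, (X e).IsSymm) (e : E) (i j : n) {α β : ℝ}
    (hα : 0 < α) (hβ : 0 < β) {ρ : ℝ} (h : ∀ t, ρ < t →
      0 < (C α * F X + C β * F (permAct (Pi.mulSingle e (Equiv.swap i j)) X)).eval t) :
    (∀ t, ρ < t → 0 < (F X).eval t) ∨
      ∀ t, ρ < t → 0 < (F (permAct (Pi.mulSingle e (Equiv.swap i j)) X)).eval t := by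
  obtain ⟨g, hg, hg'⟩ := hF.exists_interlacer hX e i j
  refine forall_pos_or_forall_pos _ _ g hg (fun z hz => ((hg' z hz).2 _ (Or.inl rfl)).1)
    (fun z hz => ((hg' z hz).2 _ (Or.inr rfl)).1) hα.le hβ.le fun t ht => ?_
  simpa using h t ht

end IsStableFamily

end Stable

/-! ### Averages over the symmetric group as products of random swaps -/

theorem Fintype.sum_sum_update {E β M : Type*} [Fintype E] [DecidableEq E] [Fintype β]
    [AddCommMonoid M] (a : E) (h : (E → β) → M) :
    ∑ g, ∑ γ, h (Function.update γ a g) = Fintype.card β • ∑ γ, h γ := by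
  have key : ∀ h : (E → β) → M,
      ∑ γ, h γ = ∑ b, ∑ f, h ((Equiv.funSplitAt a β).symm (b, f)) := fun h => by
    rw [← (Equiv.funSplitAt a β).symm.sum_comp, Fintype.sum_prod_type]
  have hu : ∀ g b f, Function.update ((Equiv.funSplitAt a β).symm (b, f)) a g =
      (Equiv.funSplitAt a β).symm (g, f) := fun g b f => by
    funext e
    rcases eq_or_ne e a with rfl | he
    · simp
    · simp [he]
  rw [key h]
  simp only [key fun γ => h (Function.update γ a _), hu]
  rw [Finset.smul_sum]
  refine Finset.sum_congr rfl fun g _ => ?_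
  rw [Finset.sum_const, Finset.card_univ]

section PermOption

variable {β M : Type*} [Fintype β] [DecidableEq β] [AddCommMonoid M]

open Equiv

theorem Equiv.Perm.card_nsmul_sum_apply (H : β → M) (b₀ : β) :
    Fintype.card β • ∑ g : Perm β, H (g b₀) = (Fintype.card β).factorial • ∑ b, H b := by
  have h : ∀ b, ∑ g : Perm β, H (g b) = ∑ g : Perm β, H (g b₀) := fun b => by
    rw [← Equiv.sum_comp (Equiv.mulRight (swap b₀ b))]
    simp
  calc Fintype.card β • ∑ g : Perm β, H (g b₀) = ∑ b, ∑ g : Perm β, H (g b) := by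
        rw [Finset.sum_congr rfl fun b _ => h b, Finset.sum_const, Finset.card_univ]
    _ = ∑ g : Perm β, ∑ b, H b := by
        rw [Finset.sum_comm]
        exact Finset.sum_congr rfl fun g _ => Equiv.sum_comp g H
    _ = _ := by rw [Finset.sum_const, Finset.card_univ, Fintype.card_perm]

/-- `Equiv.optionCongr` as a homomorphism of permutation groups. -/
def Equiv.Perm.optionCongrHom (β : Type*) : Perm β →* Perm (Option β) where
  toFun := optionCongr
  map_one' := optionCongr_one
  map_mul' g h := by
    ext o
    cases o <;> simp

omit [Fintype β] [DecidableEq β] in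
theorem Equiv.Perm.optionCongrHom_apply (g : Perm β) : optionCongrHom β g = optionCongr g := rfl

theorem Equiv.Perm.sum_option (h : Perm (Option β) → M) :
    ∑ g, h g = ∑ o, ∑ g : Perm β, h (optionCongrHom β g * swap none o) := by
  rw [← Equiv.sum_comp (Equiv.inv (Perm (Option β))), ← Equiv.sum_comp Equiv.Perm.decomposeOption.symm,
    Fintype.sum_prod_type]
  refine Finset.sum_congr rfl fun o _ => ?_
  rw [← Equiv.sum_comp (Equiv.inv (Perm β))]
  refine Finset.sum_congr rfl fun g _ => ?_
  simp [← Equiv.Perm.optionCongrHom_apply]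

/-- A uniform permutation of `k + 1` points is a uniform permutation of `k` of them, followed by one
fixed swap with the last point with probability `k / (k + 1)`, followed by another uniform
permutation of the `k` points. -/
theorem Equiv.Perm.sum_sum_optionCongr_swap (h : Perm (Option β) → M) (b₀ : β) :
    ∑ g₁ : Perm β, ∑ g₂ : Perm β, h (optionCongrHom β g₂ * optionCongrHom β g₁) +
      Fintype.card β • ∑ g₁ : Perm β, ∑ g₂ : Perm β,
        h (optionCongrHom β g₂ * (swap none (some b₀) * optionCongrHom β g₁)) =
      (Fintype.card β).factorial • ∑ g, h g := by
  set H : β → M := fun b => ∑ g : Perm β, h (optionCongrHom β g * swap none (some b)) with hH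
  have h1 : ∀ g₁ : Perm β, ∑ g₂ : Perm β, h (optionCongrHom β g₂ * optionCongrHom β g₁) =
      ∑ g : Perm β, h (optionCongrHom β g) := fun g₁ => by
    rw [← Equiv.sum_comp (Equiv.mulRight g₁) fun g => h (optionCongrHom β g)]
    simp
  have h2 : ∀ g₁ : Perm β, ∑ g₂ : Perm β,
      h (optionCongrHom β g₂ * (swap none (some b₀) * optionCongrHom β g₁)) = H (g₁⁻¹ b₀) :=
    fun g₁ => by
      rw [hH]
      dsimp only
      rw [← Equiv.sum_comp (Equiv.mulRight g₁) fun g =>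
        h (optionCongrHom β g * swap none (some (g₁⁻¹ b₀)))]
      refine Finset.sum_congr rfl fun g₂ _ => congrArg h ?_
      rw [Equiv.coe_mulRight, map_mul, mul_assoc, mul_swap_eq_swap_mul]
      simp [optionCongrHom_apply]
  have h3 : ∑ g : Perm β, H (g⁻¹ b₀) = ∑ g : Perm β, H (g b₀) :=
    Equiv.sum_comp (Equiv.inv (Perm β)) fun g => H (g b₀)
  rw [Finset.sum_congr rfl fun g₁ _ => h1 g₁, Finset.sum_congr rfl fun g₁ _ => h2 g₁,
    sum_option, Fintype.sum_option, Finset.sum_const,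
    Finset.card_univ, Fintype.card_perm, nsmul_add]
  rw [h3, card_nsmul_sum_apply]
  have h4 : swap (none : Option β) none = 1 := swap_self _
  simp only [h4, mul_one, hH]

end PermOption

/-! ### Passing root bounds from averages to single permutations -/

section Average

open Polynomial Matrix Equiv

variable {E n : Type*} [Fintype n] [DecidableEq n] [DecidableEq E]

/-- An operator on families of polynomials that preserves stability, and such that a bound for the
roots of its value is also a bound for the roots of the family at some permutation in `S` of the
argument. -/
def IsGoodOp (T : ((E → Matrix n n ℝ) → ℝ[X]) → (E → Matrix n n ℝ) → ℝ[X])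
    (S : Subgroup (E → Perm n)) : Prop :=
  ∀ F, IsStableFamily F → IsStableFamily (T F) ∧
    ∀ (ρ : ℝ) (X : E → Matrix n n ℝ), (∀ e, (X e).IsSymm) → (∀ t, ρ < t → 0 < (T F X).eval t) →
      ∃ γ ∈ S, ∀ t, ρ < t → 0 < (F (permAct γ X)).eval t

/-- The average of a family over a finite set of permutations. -/
noncomputable def permAvg {K : Type*} [Fintype K] (j : K → E → Perm n)
    (F : (E → Matrix n n ℝ) → ℝ[X]) (X : E → Matrix n n ℝ) : ℝ[X] :=
  C ((Fintype.card K : ℝ)⁻¹) * ∑ k, F (permAct (j k) X)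

namespace IsGoodOp

variable {T T' : ((E → Matrix n n ℝ) → ℝ[X]) → (E → Matrix n n ℝ) → ℝ[X]}
  {S : Subgroup (E → Perm n)}

omit [DecidableEq n] in
theorem comp (h : IsGoodOp T S) (h' : IsGoodOp T' S) : IsGoodOp (fun F => T (T' F)) S :=
  fun F hF => ⟨(h _ (h' F hF).1).1, fun ρ X hX hpos => by
    obtain ⟨γ, hγ, h1⟩ := (h _ (h' F hF).1).2 ρ X hX hpos
    obtain ⟨δ, hδ, h2⟩ := (h' F hF).2 ρ _ (permAct_isSymm hX γ) h1
    exact ⟨δ * γ, S.mul_mem hδ hγ, fun t ht => by rw [permAct_mul]; exact h2 t ht⟩⟩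

omit [DecidableEq n] in
theorem id : IsGoodOp (fun F : (E → Matrix n n ℝ) → ℝ[X] => F) S := fun _ hF =>
  ⟨hF, fun _ _ _ hpos => ⟨1, S.one_mem, hpos⟩⟩

theorem swap {e : E} {a b : n} (hS : Pi.mulSingle e (Equiv.swap a b) ∈ S) {α β : ℝ} (hα : 0 < α)
    (hβ : 0 < β) (hαβ : α + β = 1) :
    IsGoodOp (fun (F : (E → Matrix n n ℝ) → ℝ[X]) X =>
      C α * F X + C β * F (permAct (Pi.mulSingle e (Equiv.swap a b)) X)) S := fun F hF =>
  ⟨hF.swap e a b hα hβ hαβ, fun ρ X hX hpos => by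
    rcases hF.pos_or_pos hX e a b hα hβ hpos with h | h
    · exact ⟨1, S.one_mem, h⟩
    · exact ⟨_, hS, h⟩⟩

omit [DecidableEq n] in
theorem permAvg_of_unique {K : Type*} [Fintype K] [Unique K] {j : K → E → Perm n}
    (hj : j default = 1) : IsGoodOp (permAvg j) S := by
  have : permAvg j = fun F : (E → Matrix n n ℝ) → ℝ[X] => F := by
    funext F X
    simp [permAvg, hj, permAct_one]
  rw [this]
  exact id

/-- Induction on the number of points: the average over `Perm (Option β)` is the average over `Perm
β`, a random swap and the average over `Perm β` again. The hypothesis `hj` makes each transposition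
act as a single swap in one coordinate, the case in which an interlacer is known. -/
theorem permAvg_perm (α : Type*) [Fintype α] [DecidableEq α] (j : Perm α →* E → Perm n)
    (hj : ∀ i k, ∃ (e : E) (a b : n), j (Equiv.swap i k) =
        (Pi.mulSingle e (Equiv.swap a b) : E → Perm n))
    (hS : j.range ≤ S) : IsGoodOp (permAvg j) S := by
  revert j
  revert ‹DecidableEq α›
  refine Fintype.induction_empty_option (P := fun α _ => ∀ [DecidableEq α] (j : Perm α →* E → Perm n),
    (∀ i k, ∃ (e : E) (a b : n), j (Equiv.swap i k) =
      (Pi.mulSingle e (Equiv.swap a b) : E → Perm n)) → j.range ≤ S →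
    IsGoodOp (permAvg j) S) ?_ ?_ ?_ α
  · intro α β _ φ ih _ j hj hS
    classical
    let _ : Fintype α := Fintype.ofEquiv β φ.symm
    have e1 : permAvg j = permAvg (j.comp φ.permCongrHom.toMonoidHom) := by
      funext F X
      unfold permAvg
      rw [← φ.permCongrHom.toEquiv.sum_comp, Fintype.card_congr φ.permCongrHom.toEquiv]
      rfl
    rw [e1]
    refine ih _ (fun i k => ?_) ?_
    · obtain ⟨e, a, b, h⟩ := hj (φ i) (φ k)
      refine ⟨e, a, b, ?_⟩
      rw [← h]
      refine congrArg j ?_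
      ext x
      simp [Equiv.permCongr_apply, φ.injective.map_swap]
    · rintro _ ⟨g, rfl⟩
      exact hS ⟨_, rfl⟩
  · intro _ j hj hS
    exact permAvg_of_unique ((congrArg j (Subsingleton.elim _ _)).trans (map_one j))
  · intro β _ ih inst j hj hS
    classical
    rcases isEmpty_or_nonempty β with hβ | ⟨⟨b₀⟩⟩
    · exact permAvg_of_unique ((congrArg j (Subsingleton.elim _ _)).trans (map_one j))
    · obtain rfl : inst = fun x y => Option.instDecidableEq x y := Subsingleton.elim _ _
      have h1 : IsGoodOp (permAvg (j.comp (Perm.optionCongrHom β))) S := by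
        refine ih _ (fun i k => ?_) ?_
        · rw [MonoidHom.comp_apply, Perm.optionCongrHom_apply, optionCongr_swap]
          convert hj (some i) (some k)
        · rintro _ ⟨g, rfl⟩
          exact hS ⟨_, rfl⟩
      obtain ⟨e, a, b, hτ⟩ := hj none (some b₀)
      have hk : 0 < (Fintype.card β : ℝ) := by exact_mod_cast Fintype.card_pos_iff.2 ⟨b₀⟩
      set k : ℝ := ((Fintype.card β : ℕ) : ℝ) with hkdef
      -- `1 / (k + 1)` is the probability that a uniform permutation of `k + 1` points fixes the
      -- added point.
      have h2 := swap (S := S) (e := e) (a := a) (b := b) (by rw [← hτ]; exact hS ⟨_, rfl⟩)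
        (α := 1 / (k + 1)) (β := k / (k + 1)) (by positivity) (by positivity) (by field_simp; ring)
      rw [← hτ] at h2
      convert (h1.comp (h2.comp h1)) using 1
      funext F X
      have key := Perm.sum_sum_optionCongr_swap (fun g => F (permAct (j g) X)) b₀
      simp only [map_mul, permAct_mul, nsmul_eq_mul, ← C_eq_natCast] at key
      simp only [permAvg, Fintype.card_perm, MonoidHom.comp_apply, Fintype.card_option,
        Nat.factorial_succ, Nat.cast_mul, Nat.cast_add, Nat.cast_one, mul_inv, ← hkdef] at key ⊢
      have hf : C ((Fintype.card β).factorial : ℝ)⁻¹ * C ((Fintype.card β).factorial : ℝ) = 1 := by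
        rw [← C_mul, inv_mul_cancel₀ (by positivity), C_1]
      rw [Finset.sum_add_distrib, one_div, div_eq_mul_inv]
      simp only [← Finset.mul_sum, C_mul]
      linear_combination (-C ((Fintype.card β).factorial : ℝ)⁻¹ *
        C ((Fintype.card β).factorial : ℝ)⁻¹ * C (k + 1)⁻¹) * key -
        (C (k + 1)⁻¹ * C ((Fintype.card β).factorial : ℝ)⁻¹ * ∑ g, F (permAct (j g) X)) * hf

end IsGoodOp

/-- Some term of a sum of a stable family over tuples of permutations has the same bound for its
roots as the sum. -/
theorem IsStableFamily.exists_permAct_pos [Fintype E] {F : (E → Matrix n n ℝ) → ℝ[X]}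
    (hF : IsStableFamily F) {α : Type*} [Fintype α] [DecidableEq α] (J : E → Perm α →* Perm n)
    (hJ : ∀ e i k, ∃ a b, J e (Equiv.swap i k) = Equiv.swap a b) {X : E → Matrix n n ℝ}
    (hX : ∀ e, (X e).IsSymm) {ρ : ℝ}
    (hpos : ∀ t, ρ < t →
      0 < ∑ γ : E → Perm α, (F (permAct (fun e => J e (γ e)) X)).eval t) :
    ∃ γ : E → Perm α, ∀ t, ρ < t → 0 < (F (permAct (fun e => J e (γ e)) X)).eval t := by
  -- Keeping the permutations in `S` guarantees that the one finally obtained comes from a tuple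
  -- through the maps `J e`.
  let S : Subgroup (E → Perm n) := Subgroup.pi Set.univ fun e => (J e).range
  have hstep : ∀ e, IsGoodOp
      (permAvg fun g : Perm α => (Pi.mulSingle e (J e g) : E → Perm n)) S := fun e => by
    refine IsGoodOp.permAvg_perm α ((MonoidHom.mulSingle (fun _ : E => Perm n) e).comp (J e))
      (fun i k => ?_) ?_
    · obtain ⟨a, b, h⟩ := hJ e i k
      exact ⟨e, a, b, by rw [MonoidHom.comp_apply, h]; rfl⟩
    · rintro _ ⟨g, rfl⟩
      rw [Subgroup.mem_pi]
      intro e' _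
      rcases eq_or_ne e' e with rfl | he
      · exact ⟨g, by simp⟩
      · exact ⟨1, by simp [he]⟩
  have hgood : ∀ s : Finset E, IsGoodOp
      (permAvg fun (γ : E → Perm α) e => if e ∈ s then J e (γ e) else 1) S := fun s => by
    induction s using Finset.induction_on with
    | empty =>
      have : permAvg (fun (γ : E → Perm α) e => if e ∈ (∅ : Finset E) then J e (γ e) else 1) =
          fun F : (E → Matrix n n ℝ) → ℝ[X] => F := by
        funext F X
        simp only [permAvg, Finset.notMem_empty, if_false]
        rw [Finset.sum_const, Finset.card_univ, nsmul_eq_mul, ← C_eq_natCast, ← mul_assoc, ← C_mul,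
          inv_mul_cancel₀ (by exact_mod_cast Fintype.card_ne_zero), C_1, one_mul]
        exact congrArg F (permAct_one X)
      rw [this]
      exact IsGoodOp.id
    | insert a s ha ih =>
      convert (hstep a).comp ih using 1
      funext F X
      simp only [permAvg]
      have key := Fintype.sum_sum_update a fun γ : E → Perm α =>
        F (permAct (fun e => if e ∈ insert a s then J e (γ e) else 1) X)
      have h1 : ∀ (g : Perm α) (γ : E → Perm α),
          permAct (fun e => if e ∈ s then J e (γ e) else 1)
            (permAct (Pi.mulSingle a (J a g)) X) =
          permAct (fun e => if e ∈ insert a s then J e (Function.update γ a g e) else 1) X := by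
        intro g γ
        rw [← permAct_mul]
        refine congrArg (permAct · X) ?_
        funext e
        rw [Pi.mul_apply]
        rcases eq_or_ne e a with rfl | he
        · simp [ha]
        · simp [he]
      simp only [h1, ← Finset.mul_sum]
      rw [key, nsmul_eq_mul, ← C_eq_natCast, ← mul_assoc, ← mul_assoc, ← C_mul, ← C_mul,
        mul_right_comm, inv_mul_cancel₀ (by exact_mod_cast Fintype.card_ne_zero), one_mul]
  obtain ⟨γ, hγ, h⟩ := (hgood Finset.univ F hF).2 ρ X hX fun t ht => by
    simp only [permAvg, Finset.mem_univ, if_true]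
    rw [eval_mul, eval_C, eval_finsetSum]
    exact mul_pos (by positivity) (hpos t ht)
  rw [Subgroup.mem_pi] at hγ
  choose δ hδ using fun e => hγ e (Set.mem_univ e)
  exact ⟨δ, by rwa [show (fun e => J e (δ e)) = γ from funext hδ]⟩

end Average

/-! ### Characteristic polynomials of sums of symmetric matrices -/

section CharpolyFamily

open Polynomial Matrix

variable {E n : Type*} [Fintype n] [DecidableEq n]

theorem Matrix.IsSymm.aeval_charpoly_ne_zero {A : Matrix n n ℝ} (hA : A.IsSymm) {z : ℂ}
    (hz : 0 < z.im) : aeval z A.charpoly ≠ 0 := by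
  have hA' : A.IsHermitian := by
    rw [IsHermitian, conjTranspose_eq_transpose_of_trivial]
    exact hA
  rw [hA'.charpoly_eq, map_prod, Finset.prod_ne_zero_iff]
  intro i _ h
  have := congrArg Complex.im h
  simp at this
  exact hz.ne' this

/-- The matrix determinant lemma over the polynomial ring makes the characteristic polynomial affine
in `s`. -/
theorem Matrix.charpoly_sub_smul_vecMulVec (A : Matrix n n ℝ) (a : n → ℝ) (s : ℝ) :
    (A - s • vecMulVec a a).charpoly =
      A.charpoly + C s * ((A - vecMulVec a a).charpoly - A.charpoly) := by
  have h : ∀ s : ℝ, (A - s • vecMulVec a a).charpoly = A.charpoly +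
      C s * ((fun i => C (a i)) ⬝ᵥ (A.charmatrix.adjugate *ᵥ fun i => C (a i))) := fun s => by
    have : (A - s • vecMulVec a a).charmatrix =
        A.charmatrix + vecMulVec (C s • fun i => C (a i)) fun i => C (a i) := by
      ext1 i j
      simp only [charmatrix_apply, sub_apply, smul_apply, vecMulVec_apply, Matrix.add_apply,
        Pi.smul_apply, smul_eq_mul, C_sub, C_mul]
      ring
    rw [Matrix.charpoly, this, det_add_vecMulVec_eq, mulVec_smul, dotProduct_smul, smul_eq_mul,
      Matrix.charpoly]
  have h1 := h 1
  rw [one_smul, C_1, one_mul] at h1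
  rw [h s, h1, add_sub_cancel_left]

/-- The sign makes the polynomial `det (t + K + ∑ e, X e)`, so that a positive rank-one update adds
its trace to the second coefficient, as `coeff_sub` requires. -/
theorem isStableFamily_charpoly [Fintype E] [DecidableEq E] {K : Matrix n n ℝ} (hK : K.IsSymm) :
    IsStableFamily fun X : E → Matrix n n ℝ => (-(K + ∑ e, X e)).charpoly := by
  have hsymm : ∀ X : E → Matrix n n ℝ, (∀ e, (X e).IsSymm) → (-(K + ∑ e, X e)).IsSymm :=
    fun X hX => by
      rw [IsSymm, transpose_neg, transpose_add, transpose_sum, hK.eq]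
      simp only [(hX _).eq]
  have hupd : ∀ (X : E → Matrix n n ℝ) e (B : Matrix n n ℝ),
      -(K + ∑ e', Function.update X e (X e + B) e') = -(K + ∑ e', X e') - B := fun X e B => by
    rw [Finset.sum_update_of_mem (Finset.mem_univ e),
      ← Finset.add_sum_erase _ X (Finset.mem_univ e), Finset.erase_eq]
    abel
  refine ⟨fun X _ => charpoly_monic _, fun X _ => charpoly_natDegree_eq_dim _,
    fun X hX z hz => (hsymm X hX).aeval_charpoly_ne_zero hz, fun X _ e a s => ?_,
    fun X _ e a => ?_⟩
  · simp only [hupd]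
    exact charpoly_sub_smul_vecMulVec _ a s
  · simp only [hupd]
    rcases isEmpty_or_nonempty n with hn | hn
    · rw [Subsingleton.elim (-(K + ∑ e, X e) - vecMulVec a a) (-(K + ∑ e, X e)), sub_self,
        Subsingleton.elim a 0]
      simp
    · have h1 := trace_eq_neg_charpoly_coeff (-(K + ∑ e, X e))
      have h2 := trace_eq_neg_charpoly_coeff (-(K + ∑ e, X e) - vecMulVec a a)
      rw [trace_sub, trace_vecMulVec] at h2
      rw [Polynomial.coeff_sub]
      linarith

end CharpolyFamily

/-! ### Splitting off the old eigenvalues of a permutation covering -/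

namespace Matrix

section SumZero

variable {d : ℕ}

/-- The matrix of the basis `e_0`, `e_{i+1} - e_0`. -/
def sumZeroBasis (d : ℕ) : Matrix (Fin (d + 1)) (Fin (d + 1)) ℝ :=
  1 - vecMulVec (Pi.single 0 1) (1 - Pi.single 0 1)

/-- The matrix of the dual basis of `sumZeroBasis`. -/
def sumZeroDual (d : ℕ) : Matrix (Fin (d + 1)) (Fin (d + 1)) ℝ :=
  1 + vecMulVec (Pi.single 0 1) (1 - Pi.single 0 1)

theorem sumZeroDual_mul_sumZeroBasis : sumZeroDual d * sumZeroBasis d = 1 := by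
  have h : ∀ u : Fin (d + 1) → ℝ, (1 - u) ⬝ᵥ u = 0 →
      vecMulVec u (1 - u) * vecMulVec u (1 - u) = 0 := fun u hu => by
    rw [vecMulVec_mul_vecMulVec, hu, zero_smul, vecMulVec_zero]
  rw [sumZeroDual, sumZeroBasis, add_mul, one_mul, mul_sub, mul_one, h _ (by simp)]
  abel

variable (M : Matrix (Fin (d + 1)) (Fin (d + 1)) ℝ)

theorem mul_sumZeroBasis_zero (i : Fin (d + 1)) : (M * sumZeroBasis d) i 0 = M i 0 := by
  simp [sumZeroBasis, mul_sub, mul_vecMulVec, vecMulVec_apply]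

theorem mul_sumZeroBasis_succ (i : Fin (d + 1)) (j : Fin d) :
    (M * sumZeroBasis d) i j.succ = M i j.succ - M i 0 := by
  simp [sumZeroBasis, mul_sub, mul_vecMulVec, vecMulVec_apply]

theorem sumZeroDual_mul_zero (j : Fin (d + 1)) : (sumZeroDual d * M) 0 j = ∑ i, M i j := by
  simp [sumZeroDual, add_mul, vecMulVec_mul, vecMulVec_apply, sub_vecMul, vecMul, dotProduct]

theorem sumZeroDual_mul_succ (i : Fin d) (j : Fin (d + 1)) :
    (sumZeroDual d * M) i.succ j = M i.succ j := by
  simp [sumZeroDual, add_mul, vecMulVec_mul, vecMulVec_apply]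

end SumZero

section Blocks

open Polynomial

variable {V : Type*} [Fintype V] [DecidableEq V] {d : ℕ}

theorem charpoly_eq_mul_of_apply_zero_succ (N : Matrix (V × Fin (d + 1)) (V × Fin (d + 1)) ℝ)
    (hN : ∀ v w j, N (v, 0) (w, Fin.succ j) = 0) :
    N.charpoly = (of fun v w => N (v, 0) (w, 0)).charpoly *
      (of fun p q : V × Fin d => N (p.1, p.2.succ) (q.1, q.2.succ)).charpoly := by
  let φ : V ⊕ V × Fin d ≃ V × Fin (d + 1) :=
    { toFun := Sum.elim (fun v => (v, 0)) fun p => (p.1, p.2.succ)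
      invFun := fun p => Fin.cases (Sum.inl p.1) (fun i => Sum.inr (p.1, i)) p.2
      left_inv := by rintro (v | ⟨v, i⟩) <;> rfl
      right_inv := by
        rintro ⟨v, i⟩
        refine Fin.cases ?_ (fun i => ?_) i <;> rfl }
  rw [← charpoly_reindex φ.symm, ← charpoly_fromBlocks_zero₁₂
    (of fun v w => N (v, 0) (w, 0)) (of fun (p : V × Fin d) w => N (p.1, p.2.succ) (w, 0))]
  refine congrArg charpoly ?_
  ext p q
  rcases p with v | p <;> rcases q with w | q
  · rfl
  · exact hN v q.1 q.2
  · rfl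
  · rfl

theorem charpoly_conj {n : Type*} [Fintype n] [DecidableEq n] {P Q : Matrix n n ℝ} (h : P * Q = 1)
    (M : Matrix n n ℝ) : (P * M * Q).charpoly = M.charpoly := by
  rw [charpoly_mul_comm, ← Matrix.mul_assoc, mul_eq_one_comm.1 h, Matrix.one_mul]

end Blocks

end Matrix

namespace MultiGraph

open Matrix Polynomial

open scoped Kronecker

section Split

variable {V E ι : Type*} [Fintype E] [Fintype ι] [DecidableEq V] [DecidableEq ι]
  (G : MultiGraph V E)

theorem one_kronecker_mul_fibreMatrix [Fintype V] (b : Matrix ι ι ℝ) (u : V) :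
    ((1 : Matrix V V ℝ) ⊗ₖ b) * fibreMatrix ι u = fibreMatrix ι u * b := by
  ext p j
  rw [mul_apply, mul_apply, Fintype.sum_prod_type]
  simp [fibreMatrix, one_apply, ite_and, Prod.ext_iff]

theorem fibreMatrix_transpose_mul_one_kronecker [Fintype V] (b : Matrix ι ι ℝ) (u : V) :
    (fibreMatrix ι u)ᵀ * ((1 : Matrix V V ℝ) ⊗ₖ b) = b * (fibreMatrix ι u)ᵀ := by
  have h := congrArg transpose (one_kronecker_mul_fibreMatrix bᵀ u)
  rwa [transpose_mul, transpose_mul, transpose_transpose, ← kroneckerMap_transpose, transpose_one,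
    transpose_transpose] at h

theorem one_kronecker_mul_twistAdj_mul [Fintype V] (x : E → Matrix ι ι ℝ × Matrix ι ι ℝ)
    (a b : Matrix ι ι ℝ) :
    ((1 : Matrix V V ℝ) ⊗ₖ a) * G.twistAdj x * ((1 : Matrix V V ℝ) ⊗ₖ b) =
      G.twistAdj fun e => (a * (x e).1 * b, a * (x e).2 * b) := by
  rw [twistAdj, twistAdj, Finset.mul_sum, Finset.sum_mul]
  refine Finset.sum_congr rfl fun e _ => ?_
  rw [mul_add, add_mul]
  congr 1
  · rw [Matrix.mul_assoc, Matrix.mul_assoc _ _ ((1 : Matrix V V ℝ) ⊗ₖ b),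
      fibreMatrix_transpose_mul_one_kronecker, ← Matrix.mul_assoc, ← Matrix.mul_assoc,
      ← Matrix.mul_assoc, one_kronecker_mul_fibreMatrix]
    simp only [Matrix.mul_assoc]
  · rw [Matrix.mul_assoc, Matrix.mul_assoc _ _ ((1 : Matrix V V ℝ) ⊗ₖ b),
      fibreMatrix_transpose_mul_one_kronecker, ← Matrix.mul_assoc, ← Matrix.mul_assoc,
      ← Matrix.mul_assoc, one_kronecker_mul_fibreMatrix]
    simp only [Matrix.mul_assoc]

/-- The matrix of a permutation. -/
def permMat (τ : Equiv.Perm ι) : Matrix ι ι ℝ := of fun i j => if τ j = i then 1 else 0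

theorem adjMatrix_permCover (σ : E → Equiv.Perm ι) :
    (G.permCover σ).adjMatrix = G.twistAdj fun e => (permMat (σ e), permMat (σ e)⁻¹) := by
  have h := G.twistAdj_signedPerm fun e => ((1 : ι → ℤˣ), (σ e)⁻¹)
  have h1 : (G.permCover σ).adjMatrix = (G.permCover σ).signAdj fun _ => 1 := by
    simp [adjMatrix_eq_sum, signAdj]
  rw [h1]
  simp only [inv_inv, Pi.one_apply] at h
  rw [← h]
  congr 1
  funext e
  refine Prod.ext ?_ ?_
  · ext i j
    simp [permMat, signedPerm, Equiv.eq_symm_apply]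
  · ext i j
    simp [permMat, signedPerm, eq_comm]

variable {d : ℕ}

/-- In the basis `e_0`, `e_{i+1} - e_0` of each fibre, permutation matrices are block triangular
with blocks `1` and `stdPerm`, because they preserve the sum of the coordinates. The all-ones matrix
kills the vectors of sum zero, so it shifts the old block only. -/
theorem charpoly_adjMatrix_permCover_sub [Fintype V] (σ : E → Equiv.Perm (Fin (d + 1))) (s : ℝ) :
    ((G.permCover σ).adjMatrix - s • ((1 : Matrix V V ℝ) ⊗ₖ of fun _ _ => 1)).charpoly =
      (G.adjMatrix - (s * (d + 1)) • 1).charpoly *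
        (G.twistAdj fun e => (stdPerm (σ e), stdPerm (σ e)⁻¹)).charpoly := by
  have hone : ((1 : Matrix V V ℝ) ⊗ₖ sumZeroDual d) * ((1 : Matrix V V ℝ) ⊗ₖ sumZeroBasis d) = 1 := by
    rw [← mul_kronecker_mul, one_mul, sumZeroDual_mul_sumZeroBasis, one_kronecker_one]
  rw [← charpoly_conj hone, mul_sub, sub_mul, adjMatrix_permCover, one_kronecker_mul_twistAdj_mul,
    Matrix.mul_smul, Matrix.smul_mul, ← mul_kronecker_mul, ← mul_kronecker_mul, one_mul, one_mul]
  have h00 : ∀ τ : Equiv.Perm (Fin (d + 1)),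
      (sumZeroDual d * permMat τ * sumZeroBasis d) 0 0 = 1 := fun τ => by
    rw [mul_sumZeroBasis_zero, sumZeroDual_mul_zero]
    simp [permMat]
  have h01 : ∀ (τ : Equiv.Perm (Fin (d + 1))) j,
      (sumZeroDual d * permMat τ * sumZeroBasis d) 0 (Fin.succ j) = 0 := fun τ j => by
    rw [mul_sumZeroBasis_succ, sumZeroDual_mul_zero, sumZeroDual_mul_zero]
    simp [permMat]
  have h11 : ∀ (τ : Equiv.Perm (Fin (d + 1))) i j,
      (sumZeroDual d * permMat τ * sumZeroBasis d) (Fin.succ i) (Fin.succ j) = stdPerm τ i j :=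
    fun τ i j => by
      rw [mul_sumZeroBasis_succ, sumZeroDual_mul_succ, sumZeroDual_mul_succ]
      simp [permMat, stdPerm]
  have j00 : (sumZeroDual d * (of fun _ _ => 1 : Matrix (Fin (d + 1)) (Fin (d + 1)) ℝ) * sumZeroBasis d) 0 0 = d + 1 := by
    rw [mul_sumZeroBasis_zero, sumZeroDual_mul_zero]
    simp
  have j0 : ∀ i j, (sumZeroDual d * (of fun _ _ => 1 : Matrix (Fin (d + 1)) (Fin (d + 1)) ℝ) * sumZeroBasis d) i (Fin.succ j) = 0 :=
    fun i j => by
      rw [mul_sumZeroBasis_succ]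
      refine Fin.cases ?_ (fun i => ?_) i
      · rw [sumZeroDual_mul_zero, sumZeroDual_mul_zero]
        simp
      · rw [sumZeroDual_mul_succ, sumZeroDual_mul_succ]
        simp
  rw [charpoly_eq_mul_of_apply_zero_succ]
  · congr 2
    · ext v w
      rw [of_apply, Matrix.sub_apply, Matrix.sub_apply, Matrix.smul_apply, Matrix.smul_apply,
        kroneckerMap_apply, j00, twistAdj_apply, adjMatrix_eq_sum, Matrix.sum_apply]
      simp only [h00, smul_eq_mul]
      congr 1
      · refine Finset.sum_congr rfl fun e _ => ?_
        rw [Matrix.add_apply, single_apply, single_apply, add_comm]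
        simp only [eq_comm]
      · ring
    · ext p q
      rw [of_apply, Matrix.sub_apply, Matrix.smul_apply, kroneckerMap_apply, j0, twistAdj_apply,
        twistAdj_apply]
      simp only [h11, mul_zero, smul_zero, sub_zero]
  · intro v w j
    rw [Matrix.sub_apply, Matrix.smul_apply, kroneckerMap_apply, j0, twistAdj_apply]
    simp only [h01, ite_self, add_zero, Finset.sum_const_zero, mul_zero, smul_zero, sub_zero]

theorem charpoly_adjMatrix_permCover [Fintype V] (σ : E → Equiv.Perm (Fin (d + 1))) :
    (G.permCover σ).adjMatrix.charpoly = G.adjMatrix.charpoly *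
      (G.twistAdj fun e => (stdPerm (σ e), stdPerm (σ e)⁻¹)).charpoly := by
  simpa using G.charpoly_adjMatrix_permCover_sub σ 0

theorem newEigenvalues_permCoverHom [Fintype V] (σ : E → Equiv.Perm (Fin (d + 1))) :
    (G.permCoverHom σ).newEigenvalues =
      (G.twistAdj fun e => (stdPerm (σ e), stdPerm (σ e)⁻¹)).charpoly.roots := by
  rw [Hom.newEigenvalues, spec, spec, charpoly_adjMatrix_permCover, roots_mul, add_tsub_cancel_left]
  exact mul_ne_zero (charpoly_monic _).ne_zero (charpoly_monic _).ne_zero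

/-- The spectrum of a twisted adjacency matrix of a bipartite graph is symmetric. -/
theorem neg_mem_roots_charpoly_twistAdj [Fintype V] (hG : G.Bipartite)
    (x : E → Matrix ι ι ℝ × Matrix ι ι ℝ) {μ : ℝ} (hμ : μ ∈ (G.twistAdj x).charpoly.roots) :
    -μ ∈ (G.twistAdj x).charpoly.roots := by
  obtain ⟨c, hc⟩ := hG
  -- Changing signs on one colour class conjugates the twisted adjacency matrix to its negative.
  let D : Matrix (V × ι) (V × ι) ℝ := diagonal fun p => if c p.1 then 1 else -1
  have hD : D * D = 1 := by
    rw [diagonal_mul_diagonal, ← diagonal_one]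
    congr 1
    funext p
    split_ifs <;> norm_num
  have hconj : D * G.twistAdj x * D = -G.twistAdj x := by
    ext p q
    rw [mul_diagonal, diagonal_mul, Matrix.neg_apply, twistAdj_apply, Finset.mul_sum,
      Finset.sum_mul, ← Finset.sum_neg_distrib]
    refine Finset.sum_congr rfl fun e _ => ?_
    have h : ((p.1 = G.tgt e ∧ q.1 = G.src e) ∨ (p.1 = G.src e ∧ q.1 = G.tgt e)) →
        (if c p.1 then (1 : ℝ) else -1) * (if c q.1 then 1 else -1) = -1 := by
      have := hc e
      rintro (⟨h1, h2⟩ | ⟨h1, h2⟩) <;> rw [h1, h2] <;>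
        cases h3 : c (G.src e) <;> cases h4 : c (G.tgt e) <;> simp_all
    by_cases h1 : p.1 = G.tgt e ∧ q.1 = G.src e <;> by_cases h2 : p.1 = G.src e ∧ q.1 = G.tgt e
    · rw [if_pos h1, if_pos h2]
      linear_combination ((x e).1 p.2 q.2 + (x e).2 p.2 q.2) * h (Or.inl h1)
    · rw [if_pos h1, if_neg h2]
      linear_combination ((x e).1 p.2 q.2) * h (Or.inl h1)
    · rw [if_neg h1, if_pos h2]
      linear_combination ((x e).2 p.2 q.2) * h (Or.inr h2)
    · rw [if_neg h1, if_neg h2]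
      simp
  rw [mem_roots (charpoly_monic _).ne_zero, IsRoot.def, eval_charpoly] at hμ ⊢
  have h1 : D * (scalar (V × ι) (-μ) - G.twistAdj x) * D = -(scalar (V × ι) μ - G.twistAdj x) := by
    rw [mul_sub, sub_mul, hconj, ← (scalar_commute (-μ) (fun _ => Commute.all _ _) D).eq,
      Matrix.mul_assoc, hD, mul_one, map_neg]
    abel
  have h2 := congrArg det h1
  rw [det_mul, det_mul, mul_right_comm, ← det_mul, hD, det_one, one_mul, det_neg, hμ, mul_zero] at h2
  exact h2

end Split

end MultiGraph

/-! ### Existence of Ramanujan coverings -/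

namespace MultiGraph

open Matrix Polynomial

open scoped Kronecker

section Existence

variable {V E : Type*} [Fintype V] [DecidableEq V] [Fintype E] (G : MultiGraph V E)

/-- The action of permutations on the fibre over `v`. -/
def fibrePermHom (ι : Type*) (v : V) : Equiv.Perm ι →* Equiv.Perm (V × ι) where
  toFun τ := Equiv.Perm.prodExtendRight v τ
  map_one' := by
    ext1 ⟨u, i⟩
    rcases eq_or_ne u v with rfl | h
    · simp
    · simp [Equiv.Perm.prodExtendRight_apply_ne, h]
  map_mul' σ τ := by
    ext1 ⟨u, i⟩
    rcases eq_or_ne u v with rfl | h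
    · simp
    · simp [Equiv.Perm.prodExtendRight_apply_ne, h]

omit [Fintype V] in
theorem fibrePermHom_apply_self {ι : Type*} (v : V) (τ : Equiv.Perm ι) (i : ι) :
    fibrePermHom ι v τ (v, i) = (v, τ i) :=
  Equiv.Perm.prodExtendRight_apply_eq ..

omit [Fintype V] in
theorem fibrePermHom_apply_of_ne {ι : Type*} {u v : V} (h : u ≠ v) (τ : Equiv.Perm ι) (i : ι) :
    fibrePermHom ι v τ (u, i) = (u, i) :=
  Equiv.Perm.prodExtendRight_apply_ne _ h _

omit [Fintype V] in
theorem fibrePermHom_swap {ι : Type*} [DecidableEq ι] (v : V) (i k : ι) :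
    fibrePermHom ι v (Equiv.swap i k) = Equiv.swap (v, i) (v, k) := by
  ext1 ⟨u, l⟩
  rcases eq_or_ne u v with rfl | h
  · rw [fibrePermHom_apply_self]
    exact (Prod.mk_right_injective u).map_swap i k l
  · rw [fibrePermHom_apply_of_ne h, Equiv.swap_apply_of_ne_of_ne] <;> simp [h]

/-- The contribution of the lifts of an edge to the adjacency matrix of a trivial covering. -/
def edgeMatrix (ι : Type*) [Fintype ι] [DecidableEq ι] (e : E) : Matrix (V × ι) (V × ι) ℝ :=
  fibreMatrix ι (G.tgt e) * (1 : Matrix ι ι ℝ) * (fibreMatrix ι (G.src e))ᵀ +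
    fibreMatrix ι (G.src e) * (1 : Matrix ι ι ℝ) * (fibreMatrix ι (G.tgt e))ᵀ

omit [Fintype V] [Fintype E] in
theorem edgeMatrix_isSymm {ι : Type*} [Fintype ι] [DecidableEq ι] (e : E) :
    (G.edgeMatrix ι e).IsSymm := by
  rw [IsSymm, edgeMatrix, transpose_add, Matrix.mul_one, Matrix.mul_one, transpose_mul,
    transpose_mul, transpose_transpose, transpose_transpose, add_comm]

-- Relabelling the fibre over the target of `e` alone twists the lifts of `e` by `σ e`. As there are
-- no loops, the source fibre is untouched; so each edge carries its own conjugation of a fixed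
-- symmetric matrix, as the interlacing argument needs.
omit [Fintype V] in
theorem sum_submatrix_edgeMatrix {ι : Type*} [Fintype ι] [DecidableEq ι]
    (hloop : ∀ e, G.src e ≠ G.tgt e) (σ : E → Equiv.Perm ι) :
    ∑ e, (G.edgeMatrix ι e).submatrix ⇑(fibrePermHom ι (G.tgt e) (σ e))⁻¹
      ⇑(fibrePermHom ι (G.tgt e) (σ e))⁻¹ = (G.permCover σ).adjMatrix := by
  rw [adjMatrix_permCover, twistAdj]
  refine Finset.sum_congr rfl fun e _ => ?_
  ext ⟨u, i⟩ ⟨v, j⟩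
  have h1 : ∀ k, (fibrePermHom ι (G.tgt e) (σ e))⁻¹ (G.tgt e, k) = (G.tgt e, (σ e)⁻¹ k) :=
    fun k => by rw [← map_inv, fibrePermHom_apply_self]
  have h2 : ∀ w, w ≠ G.tgt e → ∀ k, (fibrePermHom ι (G.tgt e) (σ e))⁻¹ (w, k) = (w, k) :=
    fun w hw k => by rw [← map_inv, fibrePermHom_apply_of_ne hw]
  rw [submatrix_apply, edgeMatrix, Matrix.add_apply, Matrix.add_apply, fibreMatrix_mul_mul,
    fibreMatrix_mul_mul, fibreMatrix_mul_mul, fibreMatrix_mul_mul]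
  have hne := hloop e
  rcases eq_or_ne u (G.tgt e) with rfl | hu <;> rcases eq_or_ne v (G.tgt e) with rfl | hv
  · simp [h1, hne.symm]
  · simp [h1, h2 _ hv, hne.symm, one_apply, permMat, Equiv.symm_apply_eq, eq_comm (a := i)]
  · simp [h1, h2 _ hu, hne.symm, one_apply, permMat, Equiv.symm_apply_eq, eq_comm (a := i)]
  · simp [h2 _ hu, h2 _ hv, hu, hv]

/-- The eigenvalues of a matrix can be moved to the left of `ρ` by a shift. -/
theorem exists_charpoly_sub_smul_pos (A : Matrix V V ℝ) (ρ : ℝ) (c : ℝ) (hc : 0 < c) :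
    ∃ s : ℝ, ∀ t, ρ < t → 0 < (A - (s * c) • 1).charpoly.eval t := by
  obtain ⟨M, hM⟩ : ∃ M : ℝ, ∀ t, M < t → A.charpoly.eval t ≠ 0 := by
    obtain ⟨M, hM⟩ := (A.charpoly.roots.toFinset.finite_toSet).bddAbove
    refine ⟨M, fun t ht h => ht.not_ge (hM ?_)⟩
    simpa [mem_roots (charpoly_monic A).ne_zero] using h
  refine ⟨(M - ρ) / c, fun t ht => ?_⟩
  have h := (charpoly_monic A).pos_of_no_root hM (x := t + (M - ρ)) (by linarith)
  rw [eval_charpoly] at h ⊢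
  convert h using 2
  rw [div_mul_cancel₀ _ hc.ne', map_add, scalar_apply (M - ρ), smul_one_eq_diagonal]
  abel

variable {G}

theorem exists_stdPerm_charpoly_pos (hconn : G.Connected) (hloop : ∀ e, G.src e ≠ G.tgt e)
    (d : ℕ) (v₀ : V) : ∃ σ : E → Equiv.Perm (Fin (d + 1)), ∀ t, G.rho v₀ < t →
      0 < (G.twistAdj fun e => (stdPerm (σ e), stdPerm (σ e)⁻¹)).charpoly.eval t := by
  classical
  -- The shift makes the old factor positive above `ρ(G)`. As it is the same for all coverings, it
  -- can be divided out before and after a covering is selected.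
  obtain ⟨s, hs⟩ := exists_charpoly_sub_smul_pos G.adjMatrix (G.rho v₀) (d + 1) (by positivity)
  let K : Matrix (V × Fin (d + 1)) (V × Fin (d + 1)) ℝ :=
    s • ((1 : Matrix V V ℝ) ⊗ₖ of fun _ _ => 1)
  have hK : K.IsSymm := by
    refine IsSymm.smul ?_ s
    rw [IsSymm, ← kroneckerMap_transpose, transpose_one]
    rfl
  have hF := isStableFamily_charpoly (E := E) hK
  have key : ∀ σ : E → Equiv.Perm (Fin (d + 1)),
      (-(K + ∑ e, permAct (fun e => fibrePermHom (Fin (d + 1)) (G.tgt e) (σ e))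
        (fun e => -G.edgeMatrix (Fin (d + 1)) e) e)).charpoly =
      (G.adjMatrix - (s * (d + 1)) • 1).charpoly *
        (G.twistAdj fun e => (stdPerm (σ e), stdPerm (σ e)⁻¹)).charpoly := fun σ => by
    rw [← charpoly_adjMatrix_permCover_sub, ← G.sum_submatrix_edgeMatrix hloop σ]
    congr 1
    simp only [permAct, submatrix_neg, Pi.neg_apply, Finset.sum_neg_distrib]
    abel
  obtain ⟨σ, hσ⟩ := hF.exists_permAct_pos
    (fun e => fibrePermHom (Fin (d + 1)) (G.tgt e))
    (fun e i k => ⟨_, _, fibrePermHom_swap _ _ _⟩)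
    (X := fun e => -G.edgeMatrix (Fin (d + 1)) e)
    (fun e => (G.edgeMatrix_isSymm e).neg) (ρ := G.rho v₀) (fun t ht => by
      have h := sum_det_stdPerm_pos hconn hloop d ht
      simp only [key, eval_mul, ← Finset.mul_sum]
      refine mul_pos (hs t ht) ?_
      simpa only [eval_charpoly, scalar_apply, ← smul_one_eq_diagonal] using h)
  refine ⟨σ, fun t ht => ?_⟩
  have h := hσ t ht
  rw [key, eval_mul] at h
  exact pos_of_mul_pos_right h (hs t ht).le

end Existence

end MultiGraph

theorem mainTheorem6 {V E : Type*} [Fintype V] [DecidableEq V] [Fintype E]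
    (G : MultiGraph V E) (hconn : G.Connected) (hbip : G.Bipartite) (r : ℕ) (hr : 1 ≤ r) :
    ∃ (H : MultiGraph (V × Fin r) (E × Fin r)) (p : MultiGraph.Hom H G),
      p.IsCovering r ∧ p.IsRamanujan := by
  obtain ⟨d, rfl⟩ := Nat.exists_eq_add_of_le' hr
  have hloop : ∀ e, G.src e ≠ G.tgt e := fun e h => by
    obtain ⟨c, hc⟩ := hbip
    exact hc e (congrArg c h)
  have : Nonempty V := SimpleGraph.Connected.nonempty hconn
  -- Taking the least value of `G.rho` avoids having to prove that it is independent of the base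
  -- vertex.
  obtain ⟨v₀, hv₀⟩ := Finite.exists_min G.rho
  obtain ⟨σ, hσ⟩ := MultiGraph.exists_stdPerm_charpoly_pos hconn hloop d v₀
  refine ⟨G.permCover σ, G.permCoverHom σ, G.permCoverHom_isCovering σ, fun μ hμ v => ?_⟩
  rw [MultiGraph.newEigenvalues_permCoverHom] at hμ
  have hle : ∀ x ∈ (G.twistAdj fun e =>
      (Matrix.stdPerm (σ e), Matrix.stdPerm (σ e)⁻¹)).charpoly.roots, x ≤ G.rho v₀ :=
    fun x hx => not_lt.1 fun hlt => (hσ x hlt).ne' (Polynomial.isRoot_of_mem_roots hx)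
  have h1 := hle μ hμ
  have h2 := hle (-μ) (G.neg_mem_roots_charpoly_twistAdj hbip _ hμ)
  have h3 := hv₀ v
  exact ⟨by linarith, by linarith⟩
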